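/- Let $n,k$ be integers with $2\le k<n+1$ and let $\varepsilon>0$. There is an integer $M$, depending only on $n,k,\varepsilon$, such that for all real $A$ and all $\kappa,\rho,\nu>0$ there is a constant $C=C(\varepsilon)>0$, depending only on $n,k,\varepsilon,A,\kappa,\rho,\nu$, for which the following holds. For $1\le i\le k$ let $U_i\subset\mathbb R^n$ be an open set contained in the ball of radius $\rho$ centered at the origin, let $V_i\supset U_i$ be an open convex set, and let $\Sigma_i:V_i\to\mathbb R^{n+1}$ be a smooth map all of whose derivatives of order at most $M$ are bounded by $A$ on $V_i$, and with $|D\Sigma_i(\xi)v|\ge\kappa|v|$ for all $\xi\in U_i$, $v\in\mathbb R^n$. Let $$\mathcal E_if(x)=\int_{U_i}e^{ix\cdot\Sigma_i(\xi)}f(\xi)\,d\xi ,\qquad x\in\mathbb R^{n+1},$$ and let $N_i(\xi)$ be a unit vector normal to the range of $D\Sigma_i(\xi)$ (the choice of sign is irrelevant). Assume that * (transversality) the $k$-dimensional volume of the parallelepiped spanned by $N_1(\xi_1),\dots,N_k(\xi_k)$ is at least $\nu$ for all $\xi_i\in U_i$, $1\le i\le k$; * (Condition C) there are $\mu>0$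 and a $k$-dimensional affine subspace $\mathcal H\subset\mathbb R^{n+1}$ such that every point of $\Sigma_1(U_1)$ is at distance at most $\mu$ from $\mathcal H$, and such that for every orthonormal basis $N_{k+1},\dots,N_{n+1}$ of the normal space $\mathcal H^\perp$ of $\mathcal H$ one has $|\det(N_1(\xi_1),\dots,N_k(\xi_k),N_{k+1},\dots,N_{n+1})|\ge\nu$ for all $\xi_i\in U_i$, $1\le i\le k$. Then for every $R\ge1$ and all $f_i\in L^2(U_i)$, $1\le i\le k$, $$\Big\|\prod_{i=1}^k\mathcal E_if_i\Big\|_{L^{\frac2{k-1}}(B(0,R))}\le C(\varepsilon)\,\mu^{\frac{n+1-k}2}R^\varepsilon\prod_{i=1}^k\|f_i\|_{L^2(U_i)},$$ where $B(0,R)\subset\mathbb R^{n+1}$ is the ball of radius $R$ centered at the origin. In particular $C(\varepsilon)$ does not depend on $\mu$, $\mathcal H$, $R$ or the $f_i$. -/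

import Mathlib

open scoped ContDiff

noncomputable section

/-- Euclidean space of dimension `d`. -/
abbrev Euc (d : ℕ) : Type := EuclideanSpace ℝ (Fin d)

/-- The extension operator `𝓔 f (x) = ∫_U e^{i x · S(ξ)} f(ξ) dξ` of the surface parametrized by `S`
over `U`. -/
def extensionOp {n : ℕ} (U : Set (Euc n)) (S : Euc n → Euc (n + 1)) (f : Euc n → ℂ)
    (x : Euc (n + 1)) : ℂ :=
  ∫ ξ in U, Complex.exp (Complex.I * ((inner ℝ x (S ξ) : ℝ) : ℂ)) * f ξ

/-- `N` is one of the two unit normals, at the parameter `ξ`, of the surface parametrized by `S`. -/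
def IsUnitNormal {n : ℕ} (S : Euc n → Euc (n + 1)) (ξ : Euc n) (N : Euc (n + 1)) : Prop :=
  ‖N‖ = 1 ∧ ∀ v : Euc n, inner ℝ (fderiv ℝ S ξ v) N = 0

/-- The `k`-dimensional volume of the parallelepiped spanned by `v 0, …, v (k - 1)`: the square root
of the Gram determinant. -/
def parallelepipedVol {d k : ℕ} (v : Fin k → Euc d) : ℝ :=
  √(Matrix.gram ℝ v).det

/-- Regularity of a parametrized hypersurface. The map `S` is smooth on the open convex set `V`
containing the open set `U`, its derivatives of order at most `M` are bounded by `A` on `V`, `U` lies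
in the ball of radius `ρ` around the origin, and on `U` the map `S` is an immersion, with
`|DS(ξ) v| ≥ κ |v|`. -/
structure IsRegularParam {n : ℕ} (M : ℕ) (A κ ρ : ℝ) (V U : Set (Euc n))
    (S : Euc n → Euc (n + 1)) : Prop where
  isOpen_big : IsOpen V
  convex_big : Convex ℝ V
  isOpen : IsOpen U
  subset : U ⊆ V
  subset_ball : U ⊆ Metric.ball 0 ρ
  smooth : ContDiffOn ℝ ∞ S V
  deriv_bound : ∀ m ≤ M, ∀ ξ ∈ V, ‖iteratedFDeriv ℝ m S ξ‖ ≤ A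
  immersion : ∀ ξ ∈ U, ∀ v : Euc n, κ * ‖v‖ ≤ ‖fderiv ℝ S ξ v‖

/-- Transversality of `k` hypersurfaces: `vol (N_1(ζ_1), …, N_k(ζ_k)) ≥ ν` for all choices of points
on the surfaces. -/
def Transversal {n k : ℕ} (ν : ℝ) (U : Fin k → Set (Euc n))
    (S : Fin k → Euc n → Euc (n + 1)) : Prop :=
  ∀ (ξ : Fin k → Euc n) (N : Fin k → Euc (n + 1)),
    (∀ i, ξ i ∈ U i) → (∀ i, IsUnitNormal (S i) (ξ i) (N i)) → ν ≤ parallelepipedVol N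

/-- The small support condition for the first surface (the one of index `i₁`): it lies in the
`μ`-neighbourhood of the affine subspace `H` of dimension `k`, and the normals
`N_1(ζ_1), …, N_k(ζ_k)`, completed by an orthonormal basis `N_{k+1}, …, N_{n+1}` of the normal
space of `H`, satisfy `|det (N_1, …, N_{n+1})| ≥ ν`. -/
structure SmallSupportCondition {n k : ℕ} (hk : k ≤ n + 1) (i₁ : Fin k) (ν μ : ℝ)
    (H : AffineSubspace ℝ (Euc (n + 1))) (U : Fin k → Set (Euc n))
    (S : Fin k → Euc n → Euc (n + 1)) : Prop where
  finrank_eq : Module.finrank ℝ H.direction = k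
  near : ∀ ξ ∈ U i₁, S i₁ ξ ∈ Metric.cthickening μ (H : Set (Euc (n + 1)))
  det_ge : ∀ (ξ : Fin k → Euc n) (N : Fin (n + 1) → Euc (n + 1)),
    (∀ i, ξ i ∈ U i) →
    (∀ i, IsUnitNormal (S i) (ξ i) (N (Fin.castLE hk i))) →
    Orthonormal ℝ (fun j : {j : Fin (n + 1) // k ≤ (j : ℕ)} => N j) →
    Submodule.span ℝ (Set.range fun j : {j : Fin (n + 1) // k ≤ (j : ℕ)} => N j)
      = H.directionᗮ →
    ν ≤ |(Matrix.of fun i j => N i j).det|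

end

open MeasureTheory Set Filter Topology
open scoped ENNReal NNReal

/-! ### Power series expansion of oscillating factors -/

/-! The proof is an induction on scales with few scales. Put d = n + 1 - k. The surfaces are cut
into pieces of diameter about 1/q. The normals at one point of each piece are completed by an
orthonormal basis of the normal space of H. By Condition C these unit vectors N_j have determinant
at least ν, so x = Σ τ_j N_j turns balls into boxes and the phase into τ · s, where s_j = N_j ·
Σ_i(ξ). On a piece of the i-th surface the i-th coordinate varies about q times more slowly than the
others, and on the first surface the last d coordinates vary by at most 2μ.

At scale r, consider the sum of the squared moduli of the contributions of the frequency cells of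
side 1/r. By the uncertainty principle this square function is essentially constant over distance ρ
= qr in the i-th direction and, for the first surface, over some distance ℓ ≤ ρ in the last d
directions. On a box of side comparable to ρ, Loomis–Whitney in the first k variables and Hölder in
the others bound the average of the product by the product of the averages, with loss
(ρ/ℓ)^(d/(k-1)). Orthogonality turns each average into the square function at scale ρ. This is
`multilinear_step`; its other losses do not depend on q. In `multilinear_chain` the losses of m
steps telescope to max(1, q^m μ)^(d/(k-1)).

At the last scale Q = q^m, comparable to R, Cauchy–Schwarz on each cell suffices. The cells of the
first surface have volume about Q^(-(k-1)) min(1/Q, μ)^d, and max(1, Qμ) min(1/Q, μ) ≤ μ produces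
the gain in μ (`prod_piece_volume_le`). The only loss in R is the number of pieces, a fixed power of
q; as q is comparable to R^(1/m), a large m makes it at most R^ε.

"Essentially constant" is made exact by expanding e^{iy·u}, for bounded y and u, in a power series
and keeping every monomial in u times f as a new function. Hence the square functions are taken over
families, whose total L² norm grows only by a bounded factor in each step. -/

theorem ENNReal.sq_tsum_mul_le {ι : Type*} (a b : ι → ℝ≥0∞) :
    (∑' i, a i * b i) ^ 2 ≤ (∑' i, a i ^ 2) * ∑' i, b i ^ 2 := by
  let _ : MeasurableSpace ι := ⊤
  have h := ENNReal.lintegral_mul_le_Lp_mul_Lq (Measure.count : Measure ι)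
    (p := 2) (q := 2) Real.HolderConjugate.two_two
    (f := a) (g := b) (measurable_from_top.aemeasurable) (measurable_from_top.aemeasurable)
  simp only [lintegral_count, Pi.mul_apply] at h
  calc (∑' i, a i * b i) ^ 2
      ≤ ((∑' i, a i ^ (2 : ℝ)) ^ (1 / 2 : ℝ) * (∑' i, b i ^ (2 : ℝ)) ^ (1 / 2 : ℝ)) ^ 2 := by
        gcongr
    _ = _ := by
        rw [mul_pow, ← ENNReal.rpow_natCast, ← ENNReal.rpow_natCast, ← ENNReal.rpow_mul,
          ← ENNReal.rpow_mul]
        norm_num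

/-- The oscillating factor `e^{i τ · s}`. -/
noncomputable def expo {J : Type} [Fintype J] (τ s : J → ℝ) : ℂ :=
  Complex.exp (Complex.I * ((∑ j, τ j * s j : ℝ) : ℂ))

/-- Finite words in the alphabet `J`; they index the monomials in noncommuting variables. -/
abbrev Words (J : Type) : Type := Σ m : ℕ, (Fin m → J)

/-- The normalized monomial of `u` attached to a word. -/
noncomputable def monom {J : Type} (u : J → ℝ) (w : Words J) : ℝ :=
  (∏ i, u (w.2 i)) / √(w.1.factorial)

theorem abs_monom_le {J : Type} {u : J → ℝ} {a : ℝ} (h : ∀ j, |u j| ≤ a) (w : Words J) :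
    |monom u w| ≤ monom (fun _ => a) w := by
  unfold monom
  rw [abs_div, abs_of_nonneg (Real.sqrt_nonneg _), Finset.abs_prod]
  gcongr
  exact h _

theorem measurable_monom {J : Type} (w : Words J) : Measurable fun u : J → ℝ => monom u w := by
  unfold monom
  fun_prop

section
variable {J : Type} [Fintype J]

theorem norm_expo (τ s : J → ℝ) : ‖expo τ s‖ = 1 := by
  rw [expo, mul_comm, Complex.norm_exp_ofReal_mul_I]

theorem enorm_expo (τ s : J → ℝ) : ‖expo τ s‖ₑ = 1 := by
  rw [← ofReal_norm, norm_expo, ENNReal.ofReal_one]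

theorem expo_add_left (τ τ' s : J → ℝ) : expo (τ + τ') s = expo τ s * expo τ' s := by
  simp only [expo, ← Complex.exp_add, Pi.add_apply, add_mul, Finset.sum_add_distrib]
  push_cast
  ring_nf

theorem expo_add_right (τ s s' : J → ℝ) : expo τ (s + s') = expo τ s * expo τ s' := by
  simp only [expo, ← Complex.exp_add, Pi.add_apply, mul_add, Finset.sum_add_distrib]
  push_cast
  ring_nf

theorem continuous_expo : Continuous fun p : (J → ℝ) × (J → ℝ) => expo p.1 p.2 := by
  unfold expo
  fun_prop

/-- Words instead of multi-indices avoid multinomial coefficients. The factor 1/m! is split evenly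
between the two monomials, so that the square sums on both sides of a Cauchy–Schwarz inequality are
exponential series. -/
theorem sum_monom_mul (y u : J → ℝ) (m : ℕ) :
    ∑ w : Fin m → J, monom y ⟨m, w⟩ * monom u ⟨m, w⟩ = (∑ j, y j * u j) ^ m / m.factorial := by
  rw [Fintype.sum_pow, Finset.sum_div]
  refine Finset.sum_congr rfl fun w _ => ?_
  simp only [monom]
  rw [div_mul_div_comm, Real.mul_self_sqrt (by positivity), Finset.prod_mul_distrib]

theorem summable_monom_mul {y u : J → ℝ} (hy : ∀ j, 0 ≤ y j) (hu : ∀ j, 0 ≤ u j) :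
    Summable fun w : Words J => monom y w * monom u w := by
  have h0 : ∀ w : Words J, 0 ≤ monom y w * monom u w := fun w => by
    unfold monom
    have := Finset.prod_nonneg (s := Finset.univ) fun i _ => hy (w.2 i)
    have := Finset.prod_nonneg (s := Finset.univ) fun i _ => hu (w.2 i)
    positivity
  rw [summable_sigma_of_nonneg h0]
  refine ⟨fun m => Summable.of_finite, ?_⟩
  simp only [tsum_fintype, sum_monom_mul]
  exact Real.summable_pow_div_factorial _

theorem hasSum_expo (y u : J → ℝ) :
    HasSum (fun w : Words J => Complex.I ^ w.1 * (monom y w : ℂ) * (monom u w : ℂ))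
      (expo y u) := by
  refine HasSum.sigma_of_hasSum (g := fun m : ℕ =>
      (Complex.I * ((∑ j, y j * u j : ℝ) : ℂ)) ^ m / m.factorial) ?_ ?_ ?_
  · rw [expo, Complex.exp_eq_exp_ℂ]
    exact NormedSpace.expSeries_div_hasSum_exp _
  · intro m
    convert hasSum_fintype _ using 1
    simp only [mul_assoc]
    rw [← Finset.mul_sum, mul_pow, mul_div_assoc]
    congr 1
    exact_mod_cast (sum_monom_mul y u m).symm
  · refine Summable.of_norm_bounded (g := fun w : Words J =>
      monom (fun j => |y j|) w * monom (fun j => |u j|) w)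
      (summable_monom_mul (fun _ => abs_nonneg _) (fun _ => abs_nonneg _)) fun w => ?_
    have h1 : ∀ v : J → ℝ, |monom v w| = monom (fun j => |v j|) w := fun v => by
      simp only [monom, abs_div, Finset.abs_prod, abs_of_nonneg (Real.sqrt_nonneg _)]
    simp [h1]

/-- The constant controlling the square sum of the monomials of a vector with entries at most
`a`. -/
noncomputable def monomConst (J : Type) [Fintype J] (a : ℝ) : ℝ≥0∞ :=
  ENNReal.ofReal (Real.exp (Fintype.card J * a ^ 2))

theorem monomConst_ne_top (a : ℝ) : monomConst J a ≠ ⊤ := ENNReal.ofReal_ne_top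

theorem tsum_monom_sq_le {u : J → ℝ} {a : ℝ} (h : ∀ j, |u j| ≤ a) :
    ∑' w : Words J, ‖(monom u w : ℂ)‖ₑ ^ 2 ≤ monomConst J a := by
  have h1 : ∀ w : Words J, ‖(monom u w : ℂ)‖ₑ ^ 2 = ENNReal.ofReal (monom u w * monom u w) := by
    intro w
    rw [← ofReal_norm, Complex.norm_real, ← ENNReal.ofReal_pow (norm_nonneg _)]
    simp [sq]
  simp only [h1]
  rw [ENNReal.tsum_sigma']
  have h2 : ∀ m : ℕ, ∑' w : Fin m → J, ENNReal.ofReal (monom u ⟨m, w⟩ * monom u ⟨m, w⟩) =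
      ENNReal.ofReal ((∑ j, u j * u j) ^ m / m.factorial) := by
    intro m
    rw [tsum_fintype, ← ENNReal.ofReal_sum_of_nonneg fun _ _ => mul_self_nonneg _, sum_monom_mul]
  simp only [h2]
  have h0 : 0 ≤ ∑ j, u j * u j := Finset.sum_nonneg fun _ _ => mul_self_nonneg _
  rw [← ENNReal.ofReal_tsum_of_nonneg (fun m => by positivity) (Real.summable_pow_div_factorial _)]
  refine ENNReal.ofReal_le_ofReal ?_
  rw [← (NormedSpace.expSeries_div_hasSum_exp (𝔸 := ℝ) (∑ j, u j * u j)).tsum_eq.symm,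
    ← Real.exp_eq_exp_ℝ, Real.exp_le_exp]
  calc ∑ j, u j * u j ≤ ∑ _j : J, a ^ 2 := by
        refine Finset.sum_le_sum fun j _ => ?_
        rw [← sq, ← sq_abs]
        exact pow_le_pow_left₀ (abs_nonneg _) (h j) 2
    _ = _ := by simp

/-- The series separates y from ξ, and Cauchy–Schwarz over words bounds the part depending on y. A
bounded modulation is thus traded for the moments of g, uniformly in y. -/
theorem enorm_integral_expo_sq_le {X : Type*} [MeasurableSpace X] {ν : Measure X} {g : X → ℂ}
    (hg : Integrable g ν) {u : X → J → ℝ} (hu : Measurable u) {a b : ℝ}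
    (ha : ∀ ξ j, |u ξ j| ≤ a) {y : J → ℝ} (hb : ∀ j, |y j| ≤ b) :
    ‖∫ ξ, expo y (u ξ) * g ξ ∂ν‖ₑ ^ 2 ≤
      monomConst J b * ∑' w : Words J, ‖∫ ξ, (monom (u ξ) w : ℂ) * g ξ ∂ν‖ₑ ^ 2 := by
  have hm : ∀ w : Words J, Measurable fun ξ => (monom (u ξ) w : ℂ) := fun w =>
    Complex.measurable_ofReal.comp ((measurable_monom w).comp hu)
  have hint : ∀ w : Words J, Integrable (fun ξ => (monom (u ξ) w : ℂ) * g ξ) ν := fun w =>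
    hg.bdd_mul (c := monom (fun _ => a) w) (hm w).aestronglyMeasurable
      (Eventually.of_forall fun ξ => by
        rw [Complex.norm_real]; exact abs_monom_le (ha ξ) w)
  have hexp : (fun ξ => expo y (u ξ) * g ξ) = fun ξ => ∑' w : Words J,
      Complex.I ^ w.1 * (monom y w : ℂ) * ((monom (u ξ) w : ℂ) * g ξ) := by
    funext ξ
    rw [← (hasSum_expo y (u ξ)).tsum_eq, ← tsum_mul_right]
    simp only [mul_assoc]
  have hb0 : ∀ j : J, 0 ≤ b := fun j => (abs_nonneg _).trans (hb j)
  have hsum : Summable fun w : Words J =>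
      ∫ ξ, ‖Complex.I ^ w.1 * (monom y w : ℂ) * ((monom (u ξ) w : ℂ) * g ξ)‖ ∂ν := by
    -- A point of `X` is needed to deduce 0 ≤ a, which the comparison series requires.
    rcases isEmpty_or_nonempty X with hX | ⟨⟨ξ₀⟩⟩
    · simp [Measure.eq_zero_of_isEmpty ν, summable_zero]
    refine Summable.of_nonneg_of_le (fun w => integral_nonneg fun ξ => norm_nonneg _) (fun w => ?_)
      ((summable_monom_mul (y := fun _ : J => b) (u := fun _ => a) hb0
        (fun j => (abs_nonneg _).trans (ha ξ₀ j))).mul_right (∫ ξ, ‖g ξ‖ ∂ν))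
    rw [← integral_const_mul]
    refine integral_mono_of_nonneg (Eventually.of_forall fun ξ => norm_nonneg _)
      (hg.norm.const_mul _) (Eventually.of_forall fun ξ => ?_)
    simp only [norm_mul, norm_pow, Complex.norm_I, one_pow, one_mul, Complex.norm_real]
    rw [← mul_assoc]
    gcongr
    · exact (abs_nonneg _).trans (abs_monom_le hb w)
    · exact abs_monom_le hb w
    · exact abs_monom_le (ha ξ) w
  have hS := (hasSum_integral_of_summable_integral_norm
    (fun w => (hint w).const_mul _) hsum).tsum_eq
  rw [hexp, ← hS]
  calc ‖∑' w : Words J, ∫ ξ, Complex.I ^ w.1 * (monom y w : ℂ) * ((monom (u ξ) w : ℂ) * g ξ) ∂ν‖ₑ ^ 2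
      ≤ (∑' w : Words J, ‖(monom y w : ℂ)‖ₑ * ‖∫ ξ, (monom (u ξ) w : ℂ) * g ξ ∂ν‖ₑ) ^ 2 := by
        gcongr
        refine enorm_tsum_le_tsum_enorm.trans (ENNReal.tsum_le_tsum fun w => ?_)
        rw [integral_const_mul, enorm_mul, enorm_mul, enorm_pow]
        simp [← ofReal_norm Complex.I]
    _ ≤ _ := (ENNReal.sq_tsum_mul_le _ _).trans (by gcongr; exact tsum_monom_sq_le hb)

end

/-! ### Orthogonality on boxes -/

/-- The cube of side `2 r` centered at the origin. -/
def box (J : Type) (r : ℝ) : Set (J → ℝ) := Set.pi univ fun _ => Icc (-r) r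

theorem mem_box {J : Type} {r : ℝ} {τ : J → ℝ} : τ ∈ box J r ↔ ∀ j, |τ j| ≤ r := by
  simp only [box, mem_univ_pi, mem_Icc, abs_le]

theorem box_mono (J : Type) {r r' : ℝ} (h : r ≤ r') : box J r ⊆ box J r' := fun _ hτ =>
  mem_box.2 fun j => (mem_box.1 hτ j).trans h

theorem measurableSet_box (J : Type) [Fintype J] (r : ℝ) : MeasurableSet (box J r) :=
  MeasurableSet.univ_pi fun _ => measurableSet_Icc

theorem isCompact_box (J : Type) (r : ℝ) : IsCompact (box J r) :=
  isCompact_univ_pi fun _ => isCompact_Icc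

theorem volume_box (J : Type) [Fintype J] (r : ℝ) :
    volume (box J r) = ENNReal.ofReal (2 * r) ^ Fintype.card J := by
  rw [box, volume_pi, Measure.pi_pi]
  simp [Real.volume_Icc, two_mul]

section
variable {J : Type} [Fintype J]

theorem expo_eq_prod (τ s : J → ℝ) :
    expo τ s = ∏ j, Complex.exp (Complex.I * ((τ j * s j : ℝ) : ℂ)) := by
  rw [expo, ← Complex.exp_sum, ← Finset.mul_sum]
  push_cast
  rfl

theorem integral_exp_lattice {r : ℝ} (hr : 0 < r) (m : ℤ) :
    ∫ t in Icc (-(Real.pi * r)) (Real.pi * r), Complex.exp (Complex.I * ((t * (m / r) : ℝ) : ℂ)) =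
      if m = 0 then ((2 * (Real.pi * r) : ℝ) : ℂ) else 0 := by
  have hle : -(Real.pi * r) ≤ Real.pi * r := by have := Real.pi_pos; nlinarith [mul_pos this hr]
  rw [integral_Icc_eq_integral_Ioc, ← intervalIntegral.integral_of_le hle]
  split_ifs with h
  · subst h
    simp
    ring
  · have hc : Complex.I * (m / r : ℂ) ≠ 0 := by
      have : (r : ℂ) ≠ 0 := by exact_mod_cast hr.ne'
      have : (m : ℂ) ≠ 0 := by exact_mod_cast h
      simp_all
    have h1 : ∀ t : ℝ, Complex.exp (Complex.I * ((t * (m / r) : ℝ) : ℂ)) =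
        Complex.exp (Complex.I * (m / r : ℂ) * t) := fun t => by
      congr 1; push_cast; ring
    simp only [h1]
    rw [integral_exp_mul_complex hc]
    have hr' : (r : ℂ) ≠ 0 := by exact_mod_cast hr.ne'
    have h2 : Complex.exp (Complex.I * (m / r : ℂ) * (Real.pi * r : ℝ)) =
        Complex.exp (Complex.I * (m / r : ℂ) * (-(Real.pi * r) : ℝ)) := by
      rw [Complex.exp_eq_exp_iff_exists_int]
      refine ⟨m, ?_⟩
      push_cast
      field_simp
      ring
    rw [h2, sub_self, zero_div]

theorem integral_expo_lattice {r : ℝ} (hr : 0 < r) (m : J → ℤ) :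
    ∫ τ in box J (Real.pi * r), expo τ (fun j => m j / r) =
      if m = 0 then ((2 * (Real.pi * r) : ℝ) : ℂ) ^ Fintype.card J else 0 := by
  simp only [expo_eq_prod]
  rw [box, volume_pi, Measure.restrict_pi_pi,
    integral_fintype_prod_eq_prod (fun j (t : ℝ) => Complex.exp (Complex.I * ((t * (m j / r) : ℝ) : ℂ)))]
  simp only [integral_exp_lattice hr]
  split_ifs with h
  · subst h
    simp
  · obtain ⟨j, hj⟩ := Function.ne_iff.1 h
    exact Finset.prod_eq_zero (Finset.mem_univ j) (if_neg hj)

/-- Parseval: the box has side 2πr, a period of every exponential with frequency in the lattice of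
mesh 1/r, so distinct ones are orthogonal on it. -/
theorem lintegral_enorm_sum_expo_sq {r : ℝ} (hr : 0 < r) (T : Finset (J → ℤ)) (b : (J → ℤ) → ℂ) :
    ∫⁻ τ in box J (Real.pi * r), ‖∑ θ ∈ T, expo τ (fun j => θ j / r) * b θ‖ₑ ^ 2 =
      ENNReal.ofReal (2 * (Real.pi * r)) ^ Fintype.card J * ∑ θ ∈ T, ‖b θ‖ₑ ^ 2 := by
  have hcont : ∀ s : J → ℝ, Continuous fun τ => expo τ s := fun s =>
    continuous_expo.comp (Continuous.prodMk_left s)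
  have hpi := Real.pi_pos
  have h1 : ∀ z : ℂ, ‖z‖ₑ ^ 2 = ENNReal.ofReal (‖z‖ ^ 2) := fun z => by
    rw [← ofReal_norm, ENNReal.ofReal_pow (norm_nonneg _)]
  simp only [h1]
  have hint : ∀ g : (J → ℝ) → ℂ, Continuous g → IntegrableOn g (box J (Real.pi * r)) := fun g hg =>
    hg.continuousOn.integrableOn_compact (isCompact_box J _)
  have hc : Continuous fun τ : J → ℝ => ‖∑ θ ∈ T, expo τ (fun j => θ j / r) * b θ‖ ^ 2 := by
    have : ∀ θ : J → ℤ, Continuous fun τ => expo τ (fun j => (θ j : ℝ) / r) := fun θ => hcont _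
    fun_prop
  rw [← ofReal_integral_eq_lintegral_ofReal (hc.continuousOn.integrableOn_compact (isCompact_box J _))
    (Eventually.of_forall fun _ => by positivity), ← ENNReal.ofReal_sum_of_nonneg
    (fun _ _ => by positivity), ← ENNReal.ofReal_pow (by positivity), ← ENNReal.ofReal_mul
    (by positivity)]
  congr 1
  apply Complex.ofReal_injective
  rw [← integral_complex_ofReal]
  have hconj : ∀ τ s : J → ℝ, (starRingEnd ℂ) (expo τ s) = expo τ (-s) := fun τ s => by
    rw [expo, ← Complex.exp_conj, expo]
    simp
  have h2 : ∀ τ : J → ℝ, (((‖∑ θ ∈ T, expo τ (fun j => θ j / r) * b θ‖ ^ 2 : ℝ)) : ℂ) =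
      ∑ θ ∈ T, ∑ θ' ∈ T, expo τ (fun j => ((θ - θ') j : ℤ) / r) * (b θ * (starRingEnd ℂ) (b θ')) := by
    intro τ
    push_cast
    rw [← Complex.mul_conj', map_sum, Finset.sum_mul_sum]
    refine Finset.sum_congr rfl fun θ _ => Finset.sum_congr rfl fun θ' _ => ?_
    rw [map_mul, hconj]
    have : (fun j => (((θ - θ') j : ℤ) : ℝ) / r) =
        (fun j => (θ j : ℝ) / r) + -(fun j => (θ' j : ℝ) / r) := by
      funext j; simp; ring
    rw [this, expo_add_right]
    ring
  simp only [h2]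
  rw [integral_finsetSum _ fun θ _ => ?_]
  · have h3 : ∀ θ ∈ T, ∫ τ in box J (Real.pi * r), ∑ θ' ∈ T,
        expo τ (fun j => ((θ - θ') j : ℤ) / r) * (b θ * (starRingEnd ℂ) (b θ')) =
        ((2 * (Real.pi * r) : ℝ) : ℂ) ^ Fintype.card J * ((‖b θ‖ ^ 2 : ℝ) : ℂ) := by
      intro θ hθ
      rw [integral_finsetSum _ fun θ' _ => hint (fun τ => _ * _) ((hcont _).mul continuous_const)]
      simp only [integral_mul_const, integral_expo_lattice hr]
      rw [Finset.sum_eq_single θ]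
      · rw [if_pos (sub_self θ), Complex.mul_conj']
        push_cast
        rfl
      · intro θ' _ hne
        rw [if_neg (sub_ne_zero.2 hne.symm), zero_mul]
      · exact fun h => (h hθ).elim
    rw [Finset.sum_congr rfl h3]
    push_cast
    rw [Finset.mul_sum]
  · exact hint _ (continuous_finsetSum _ fun θ' _ => (hcont _).mul continuous_const)

end

/-! ### Local square functions -/

/-- The lattice cell of side `1 / r` containing `s`. -/
noncomputable def cell {J : Type} (r : ℝ) (s : J → ℝ) : J → ℤ := fun j => ⌊r * s j⌋

/-- The parameters whose image under `s` lies in the given lattice cell of side `1 / r`. -/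
def cellSet {X J : Type} (s : X → J → ℝ) (r : ℝ) (θ : J → ℤ) : Set X :=
  (fun ξ => cell r (s ξ)) ⁻¹' {θ}

/-- The square function at scale `r` of a family of extension operators: the sum over the cells of
side `1 / r` of the squared moduli of the contributions of these cells. -/
noncomputable def squareFn {X J ι : Type} [MeasurableSpace X] [Fintype J] (ν : Measure X)
    (s : X → J → ℝ) (r : ℝ) (f : ι → X → ℂ) (c : J → ℝ) : ℝ≥0∞ :=
  ∑' a, ∑' θ, ‖∫ ξ in cellSet s r θ, expo c (s ξ) * f a ξ ∂ν‖ₑ ^ 2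

/-- The squared `L²` norm of a family of functions. -/
noncomputable def sqNorm {X ι : Type} [MeasurableSpace X] (ν : Measure X) (f : ι → X → ℂ) : ℝ≥0∞ :=
  ∑' a, ∫⁻ ξ, ‖f a ξ‖ₑ ^ 2 ∂ν

/-- Multiply a family of functions by all the monomials of `u`. -/
noncomputable def twist {X J ι : Type} (u : X → J → ℝ) (f : ι → X → ℂ) : ι × Words J → X → ℂ :=
  fun p ξ => (monom (u ξ) p.2 : ℂ) * f p.1 ξ

/-- Cut a family of functions into the pieces supported in the cells of side `1 / r`. -/
noncomputable def cut {X J ι : Type} (s : X → J → ℝ) (r : ℝ) (f : ι → X → ℂ) :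
    ι × (J → ℤ) → X → ℂ :=
  fun p => (cellSet s r p.2).indicator (f p.1)

theorem cell_mem_piFinset {X J : Type} [Fintype J] [DecidableEq J] {s : X → J → ℝ} {B : ℝ} (hB : ∀ ξ j, |s ξ j| ≤ B) {r : ℝ} (hr : 0 < r) (ξ : X) :
    cell r (s ξ) ∈ Fintype.piFinset fun _ : J => Finset.Icc ⌊-(r * B)⌋ ⌊r * B⌋ := by
  rw [Fintype.mem_piFinset]
  intro j
  have := abs_le.1 (hB ξ j)
  rw [Finset.mem_Icc]
  constructor
  · exact Int.floor_le_floor (by nlinarith)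
  · exact Int.floor_le_floor (by nlinarith)

section
variable {X J ι : Type} [MeasurableSpace X] {ν : Measure X} {s : X → J → ℝ}

theorem measurable_cell (r : ℝ) (hs : Measurable s) : Measurable fun ξ => cell r (s ξ) := by
  unfold cell
  refine measurable_pi_lambda _ fun j => Int.measurable_floor.comp ?_
  fun_prop

theorem integrable_twist {u : X → J → ℝ} (hu : Measurable u) {a : ℝ} (ha : ∀ ξ j, |u ξ j| ≤ a)
    {f : ι → X → ℂ} (hf : ∀ i, Integrable (f i) ν) (p : ι × Words J) :
    Integrable (twist u f p) ν :=
  (hf p.1).bdd_mul (c := monom (fun _ => a) p.2)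
    (Complex.measurable_ofReal.comp ((measurable_monom p.2).comp hu)).aestronglyMeasurable
    (Eventually.of_forall fun ξ => by
      rw [Complex.norm_real]; exact abs_monom_le (ha ξ) p.2)

end

section
variable {X J ι : Type} [MeasurableSpace X] [Fintype J] {ν : Measure X} {s : X → J → ℝ}

theorem measurableSet_cellSet (r : ℝ) (hs : Measurable s) (θ : J → ℤ) :
    MeasurableSet (cellSet s r θ) :=
  measurable_cell r hs (measurableSet_singleton θ)

theorem measurable_expo (hs : Measurable s) (c : J → ℝ) : Measurable fun ξ => expo c (s ξ) :=
  (continuous_expo.comp (Continuous.prodMk_right c)).measurable.comp hs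

theorem integrable_expo_mul (hs : Measurable s) (c : J → ℝ) {g : X → ℂ} (hg : Integrable g ν) :
    Integrable (fun ξ => expo c (s ξ) * g ξ) ν :=
  hg.bdd_mul (c := 1) (measurable_expo hs c).aestronglyMeasurable
    (Eventually.of_forall fun _ => (norm_expo _ _).le)

/-- The price of absorbing a modulation into the family: the squared monomials sum pointwise to a
bounded quantity. -/
theorem sqNorm_twist_le {u : X → J → ℝ} (hu : Measurable u) {a : ℝ} (ha : ∀ ξ j, |u ξ j| ≤ a)
    {f : ι → X → ℂ} (hf : ∀ i, Integrable (f i) ν) :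
    sqNorm ν (twist u f) ≤ monomConst J a * sqNorm ν f := by
  unfold sqNorm
  rw [ENNReal.tsum_prod', ← ENNReal.tsum_mul_left]
  refine ENNReal.tsum_le_tsum fun i => ?_
  rw [← lintegral_tsum fun w => ?_]
  · rw [← lintegral_const_mul' _ _ (monomConst_ne_top _)]
    refine lintegral_mono fun ξ => ?_
    simp only [twist, enorm_mul, mul_pow]
    rw [ENNReal.tsum_mul_right]
    gcongr
    exact tsum_monom_sq_le (ha ξ)
  · exact (integrable_twist hu ha hf (i, w)).aestronglyMeasurable.enorm.pow_const 2

theorem integrable_cut (r : ℝ) (hs : Measurable s) {f : ι → X → ℂ}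
    (hf : ∀ i, Integrable (f i) ν) (p : ι × (J → ℤ)) : Integrable (cut s r f p) ν :=
  (hf p.1).indicator (measurableSet_cellSet r hs p.2)

theorem sqNorm_cut_le (r : ℝ) (hs : Measurable s) (f : ι → X → ℂ) :
    sqNorm ν (cut s r f) ≤ sqNorm ν f := by
  unfold sqNorm
  rw [ENNReal.tsum_prod']
  refine ENNReal.tsum_le_tsum fun i => ?_
  have h1 : ∀ θ : J → ℤ, ∫⁻ ξ, ‖cut s r f (i, θ) ξ‖ₑ ^ 2 ∂ν =
      ∫⁻ ξ in cellSet s r θ, ‖f i ξ‖ₑ ^ 2 ∂ν := by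
    intro θ
    rw [← lintegral_indicator (measurableSet_cellSet r hs θ)]
    refine lintegral_congr fun ξ => ?_
    by_cases h : ξ ∈ cellSet s r θ <;> simp [cut, h]
  simp only [h1]
  rw [← lintegral_iUnion (measurableSet_cellSet r hs)]
  · exact setLIntegral_le_lintegral _ _
  · intro θ θ' hne
    exact Disjoint.preimage _ (by simpa using hne)

/-- Local constancy. Inside a cell, y · s differs from its value at the reference point `sbar` by
(y/ℓ) · u with both factors bounded. The value at the reference point gives a unimodular constant,
which the modulus ignores; the rest is expanded in the series. Cells of width a/ℓ_j in the
coordinate j thus allow shifts by b ℓ_j. -/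
theorem squareFn_add_le {r : ℝ} (hs : Measurable s) {f : ι → X → ℂ}
    (hf : ∀ i, Integrable (f i) ν) {ℓ : J → ℝ} (hℓ : ∀ j, 0 < ℓ j) {sbar : (J → ℤ) → J → ℝ}
    {u : X → J → ℝ} (hu : ∀ ξ j, u ξ j = ℓ j * (s ξ j - sbar (cell r (s ξ)) j)) {a b : ℝ}
    (ha : ∀ ξ j, |u ξ j| ≤ a) {y : J → ℝ} (hy : ∀ j, |y j| ≤ b * ℓ j) (c : J → ℝ) :
    squareFn ν s r f (c + y) ≤ monomConst J b * squareFn ν s r (twist u f) c := by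
  have hum : Measurable u := by
    refine measurable_pi_lambda _ fun j => ?_
    simp only [hu]
    have h1 : Measurable fun ξ => sbar (cell r (s ξ)) j := (Measurable.of_discrete
      (f := fun θ => sbar θ j)).comp (measurable_cell r hs)
    exact ((measurable_pi_iff.1 hs j).sub h1).const_mul _
  unfold squareFn
  rw [ENNReal.tsum_prod', ← ENNReal.tsum_mul_left]
  refine ENNReal.tsum_le_tsum fun i => ?_
  rw [ENNReal.tsum_comm, ← ENNReal.tsum_mul_left]
  refine ENNReal.tsum_le_tsum fun θ => ?_
  have h1 : ∫ ξ in cellSet s r θ, expo (c + y) (s ξ) * f i ξ ∂ν = expo y (sbar θ) *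
      ∫ ξ in cellSet s r θ, expo (fun j => y j / ℓ j) (u ξ) * (expo c (s ξ) * f i ξ) ∂ν := by
    rw [← integral_const_mul]
    refine setIntegral_congr_fun (measurableSet_cellSet r hs θ) fun ξ hξ => ?_
    have hc : cell r (s ξ) = θ := hξ
    have h2 : expo y (s ξ) = expo y (sbar θ) * expo (fun j => y j / ℓ j) (u ξ) := by
      have : expo (fun j => y j / ℓ j) (u ξ) = expo y (s ξ - sbar θ) := by
        simp only [expo]
        congr 3
        refine Finset.sum_congr rfl fun j _ => ?_
        rw [hu, hc, Pi.sub_apply]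
        have := (hℓ j).ne'
        field_simp
      rw [this, ← expo_add_right, add_sub_cancel]
    simp only [expo_add_left, h2]
    ring
  rw [h1, enorm_mul, enorm_expo, one_mul]
  refine (enorm_integral_expo_sq_le (integrable_expo_mul hs c (hf i)).integrableOn hum ha
    (b := b) fun j => ?_).trans_eq ?_
  · rw [abs_div, abs_of_pos (hℓ j), div_le_iff₀ (hℓ j)]
    exact hy j
  · congr 1
    refine tsum_congr fun w => ?_
    simp only [twist]
    congr 3
    funext ξ
    ring

theorem integral_eq_sum_cellSet [DecidableEq J] {B : ℝ} (hB : ∀ ξ j, |s ξ j| ≤ B) {r : ℝ}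
    (hr : 0 < r) (hs : Measurable s) {g : X → ℂ} (hg : Integrable g ν) :
    ∫ ξ, g ξ ∂ν = ∑ θ ∈ Fintype.piFinset fun _ : J => Finset.Icc ⌊-(r * B)⌋ ⌊r * B⌋,
      ∫ ξ in cellSet s r θ, g ξ ∂ν := by
  rw [← integral_biUnion_finset _ (fun θ _ => measurableSet_cellSet r hs θ) _
    (fun θ _ => hg.integrableOn)]
  · rw [← setIntegral_univ]
    congr 2
    symm
    rw [eq_univ_iff_forall]
    intro ξ
    simp only [mem_iUnion]
    exact ⟨_, cell_mem_piFinset hB hr ξ, rfl⟩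
  · intro θ _ θ' _ hne
    exact Disjoint.preimage _ (by simpa using hne)

/-- Averaging a square function over a box of side `r` produces the square function at scale `r`. -/
theorem lintegral_squareFn_le [Countable ι] {B : ℝ} (hB : ∀ ξ j, |s ξ j| ≤ B) {r₀ r : ℝ} (hr : 0 < r)
    (hs : Measurable s) {f : ι → X → ℂ} (hf : ∀ i, Integrable (f i) ν)
    {u : X → J → ℝ} (hu : ∀ ξ j, u ξ j = r * s ξ j - cell r (s ξ) j) (c : J → ℝ) :
    ∫⁻ τ in box J (2 * r), squareFn ν s r₀ f (c + τ) ≤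
      monomConst J 2 * ENNReal.ofReal (2 * (Real.pi * r)) ^ Fintype.card J *
        squareFn ν s r (twist u (cut s r₀ f)) c := by
  classical
  have hum : Measurable u := by
    refine measurable_pi_lambda _ fun j => ?_
    simp only [hu]
    have h1 : Measurable fun ξ => ((cell r (s ξ) j : ℤ) : ℝ) := (Measurable.of_discrete
      (f := fun θ : J → ℤ => ((θ j : ℤ) : ℝ))).comp (measurable_cell r hs)
    fun_prop
  have hua : ∀ ξ j, |u ξ j| ≤ 1 := fun ξ j => by
    rw [hu, cell, abs_of_nonneg (sub_nonneg.2 (Int.floor_le _))]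
    linarith [Int.lt_floor_add_one (r * s ξ j)]
  set T := Fintype.piFinset fun _ : J => Finset.Icc ⌊-(r * B)⌋ ⌊r * B⌋ with hT
  set b : (ι × (J → ℤ)) × Words J → (J → ℤ) → ℂ := fun p θ =>
    ∫ ξ in cellSet s r θ, expo c (s ξ) * twist u (cut s r₀ f) p ξ ∂ν with hb
  have hfc := integrable_cut r₀ hs hf
  -- Split τ · s into (τ/r) · u plus τ · (cell/r), with u the fractional part of r s. The first
  -- phase has |τ_j/r| ≤ 2 and is absorbed by the series; the second depends only on the new cell,
  -- which leaves a trigonometric polynomial with lattice frequencies. Cutting along the old cells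
  -- beforehand means that old and new cells need not be nested.
  have key : ∀ τ ∈ box J (2 * r), squareFn ν s r₀ f (c + τ) ≤ monomConst J 2 *
      ∑' p : (ι × (J → ℤ)) × Words J, ‖∑ θ ∈ T, expo τ (fun j => θ j / r) * b p θ‖ₑ ^ 2 := by
    intro τ hτ
    unfold squareFn
    rw [ENNReal.tsum_prod', ENNReal.tsum_prod', ← ENNReal.tsum_mul_left]
    refine ENNReal.tsum_le_tsum fun i => ?_
    rw [← ENNReal.tsum_mul_left]
    refine ENNReal.tsum_le_tsum fun θ => ?_
    have h1 : ∫ ξ in cellSet s r₀ θ, expo (c + τ) (s ξ) * f i ξ ∂ν =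
        ∫ ξ, expo (fun j => τ j / r) (u ξ) *
          (expo τ (fun j => cell r (s ξ) j / r) * (expo c (s ξ) * cut s r₀ f (i, θ) ξ)) ∂ν := by
      rw [← integral_indicator (measurableSet_cellSet r₀ hs θ)]
      congr 1
      funext ξ
      have h2 : expo τ (s ξ) = expo (fun j => τ j / r) (u ξ) *
          expo τ (fun j => cell r (s ξ) j / r) := by
        have : expo (fun j => τ j / r) (u ξ) = expo τ (s ξ - fun j => cell r (s ξ) j / r) := by
          simp only [expo]
          congr 3
          refine Finset.sum_congr rfl fun j _ => ?_
          rw [hu, Pi.sub_apply]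
          field_simp
        rw [this, ← expo_add_right, sub_add_cancel]
      by_cases h : ξ ∈ cellSet s r₀ θ
      · simp only [indicator_of_mem h, cut, expo_add_left, h2]
        ring
      · simp [cut, indicator_of_notMem h]
    have hmc : Measurable fun ξ => (fun j => ((cell r (s ξ) j : ℤ) : ℝ) / r : J → ℝ) :=
      (Measurable.of_discrete (f := fun θ : J → ℤ => (fun j => ((θ j : ℤ) : ℝ) / r : J → ℝ))).comp
        (measurable_cell r hs)
    rw [h1]
    refine (enorm_integral_expo_sq_le (integrable_expo_mul hmc τ
      (integrable_expo_mul hs c (hfc _))) hum hua (b := 2) fun j => ?_).trans_eq ?_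
    · rw [abs_div, abs_of_pos hr, div_le_iff₀ hr]
      exact mem_box.1 hτ j
    congr 1
    refine tsum_congr fun w => ?_
    have h3 : (fun ξ => (monom (u ξ) w : ℂ) * (expo τ (fun j => cell r (s ξ) j / r) *
        (expo c (s ξ) * cut s r₀ f (i, θ) ξ))) = fun ξ => expo τ (fun j => cell r (s ξ) j / r) *
        (expo c (s ξ) * twist u (cut s r₀ f) ((i, θ), w) ξ) := by
      funext ξ
      simp only [twist]
      ring
    rw [h3, integral_eq_sum_cellSet hB hr hs (integrable_expo_mul hmc τ
      (integrable_expo_mul hs c (integrable_twist hum hua hfc _)))]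
    congr 2
    refine Finset.sum_congr rfl fun θ' _ => ?_
    rw [hb, ← integral_const_mul]
    refine setIntegral_congr_fun (measurableSet_cellSet r hs θ') fun ξ hξ => ?_
    have hc : cell r (s ξ) = θ' := hξ
    simp only [hc]
  have hcont : ∀ s : J → ℝ, Continuous fun τ => expo τ s := fun s =>
    continuous_expo.comp (Continuous.prodMk_left s)
  have hmeas : ∀ p, Measurable fun τ => ‖∑ θ ∈ T, expo τ (fun j => θ j / r) * b p θ‖ₑ ^ 2 := by
    intro p
    refine Measurable.pow_const (Measurable.enorm (Continuous.measurable ?_)) 2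
    exact continuous_finsetSum _ fun θ _ => (hcont _).mul continuous_const
  calc ∫⁻ τ in box J (2 * r), squareFn ν s r₀ f (c + τ)
      ≤ ∫⁻ τ in box J (2 * r), monomConst J 2 *
          ∑' p : (ι × (J → ℤ)) × Words J, ‖∑ θ ∈ T, expo τ (fun j => θ j / r) * b p θ‖ₑ ^ 2 :=
        setLIntegral_mono' (measurableSet_box _ _) key
    -- Since 2 < π, the box can be enlarged to one on which the lattice exponentials are orthogonal.
    _ ≤ ∫⁻ τ in box J (Real.pi * r), monomConst J 2 *
          ∑' p : (ι × (J → ℤ)) × Words J, ‖∑ θ ∈ T, expo τ (fun j => θ j / r) * b p θ‖ₑ ^ 2 :=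
        lintegral_mono_set (box_mono J (by nlinarith [Real.pi_gt_three]))
    _ = monomConst J 2 * ∑' p : (ι × (J → ℤ)) × Words J,
          ∫⁻ τ in box J (Real.pi * r), ‖∑ θ ∈ T, expo τ (fun j => θ j / r) * b p θ‖ₑ ^ 2 := by
        rw [lintegral_const_mul' _ _ (monomConst_ne_top _), lintegral_tsum fun p =>
          (hmeas p).aemeasurable]
    _ ≤ _ := by
        simp only [lintegral_enorm_sum_expo_sq hr]
        rw [ENNReal.tsum_mul_left, mul_assoc]
        gcongr
        unfold squareFn
        gcongr with p
        exact ENNReal.sum_le_tsum T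

end

/-! ### A Loomis–Whitney inequality -/

/-- By Tonelli. This disposes of a factor of integral zero in Loomis–Whitney, which cannot be
normalized. -/
theorem lintegral_update_eq_zero_ae {k : ℕ} (i : Fin k) {h : (Fin k → ℝ) → ℝ≥0∞}
    (hm : Measurable h) (h0 : ∫⁻ t, h t = 0) :
    ∀ᵐ t : Fin k → ℝ, ∫⁻ x, h (Function.update t i x) = 0 := by
  obtain ⟨k, rfl⟩ : ∃ k', k = k' + 1 := ⟨k - 1, by have := i.pos; omega⟩
  have hmp := volume_preserving_piFinSuccAbove (fun _ : Fin (k + 1) => ℝ) i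
  set e := MeasurableEquiv.piFinSuccAbove (fun _ : Fin (k + 1) => ℝ) i with he
  have h1 : ∀ᵐ p : ℝ × (Fin k → ℝ), h (e.symm p) = 0 := by
    have := (lintegral_eq_zero_iff hm).1 h0
    exact hmp.symm.quasiMeasurePreserving.ae this
  have h2 : ∫⁻ p : ℝ × (Fin k → ℝ), h (e.symm p) = 0 := by
    rw [lintegral_congr_ae h1, lintegral_zero]
  have hm2 : Measurable fun p : ℝ × (Fin k → ℝ) => h (e.symm p) := hm.comp e.symm.measurable
  rw [Measure.volume_eq_prod, lintegral_prod_symm' _ hm2,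
    lintegral_eq_zero_iff hm2.lintegral_prod_left'] at h2
  have h3 : Measure.QuasiMeasurePreserving (fun t : Fin (k + 1) → ℝ => (e t).2) volume volume :=
    (Measure.quasiMeasurePreserving_snd (μ := (volume : Measure ℝ))).comp
      hmp.quasiMeasurePreserving
  filter_upwards [h3.ae h2] with t ht
  refine Eq.trans ?_ ht
  refine lintegral_congr fun x => ?_
  congr 1
  simp [he, MeasurableEquiv.piFinSuccAbove, Fin.insertNthEquiv, Fin.insertNth_removeNth]

/-- The Loomis–Whitney inequality for several functions. -/
theorem lintegral_prod_lintegral_update_le {k : ℕ} (hk : 2 ≤ k)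
    {h : Fin k → (Fin k → ℝ) → ℝ≥0∞} (hm : ∀ i, Measurable (h i)) :
    ∫⁻ t : Fin k → ℝ, ∏ i, (∫⁻ x, h i (Function.update t i x)) ^ (1 / ((k : ℝ) - 1)) ≤
      (k : ℝ≥0∞) ^ ((k : ℝ) / (k - 1)) * ∏ i, (∫⁻ t, h i t) ^ (1 / ((k : ℝ) - 1)) := by
  have hk1 : (0 : ℝ) < (k : ℝ) - 1 := by
    have : (2 : ℝ) ≤ k := by exact_mod_cast hk
    linarith
  have hp : 0 < 1 / ((k : ℝ) - 1) := by positivity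
  by_cases hz : ∃ i, ∫⁻ t, h i t = 0
  · obtain ⟨i, hi⟩ := hz
    have : ∫⁻ t : Fin k → ℝ, ∏ i, (∫⁻ x, h i (Function.update t i x)) ^ (1 / ((k : ℝ) - 1)) = 0 := by
      rw [← lintegral_zero (μ := (volume : Measure (Fin k → ℝ)))]
      refine lintegral_congr_ae ?_
      filter_upwards [lintegral_update_eq_zero_ae i (hm i) hi] with t ht
      exact Finset.prod_eq_zero (Finset.mem_univ i) (by rw [ht, ENNReal.zero_rpow_of_pos hp])
    rw [this]
    exact zero_le
  push Not at hz
  have hrpos : ∀ i, (∫⁻ t, h i t) ^ (1 / ((k : ℝ) - 1)) ≠ 0 := fun i => by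
    simp only [ne_eq, ENNReal.rpow_eq_zero_iff, hz i, hp.not_gt, false_and, and_false, or_self,
      not_false_eq_true]
  by_cases htop : ∃ i, ∫⁻ t, h i t = ⊤
  · obtain ⟨i, hi⟩ := htop
    have h1 : ∏ i, (∫⁻ t, h i t) ^ (1 / ((k : ℝ) - 1)) = ⊤ := by
      rw [← Finset.mul_prod_erase _ _ (Finset.mem_univ i), hi, ENNReal.top_rpow_of_pos hp]
      exact ENNReal.top_mul (Finset.prod_ne_zero_iff.2 fun j _ => hrpos j)
    rw [h1, ENNReal.mul_top]
    · exact le_top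
    · have : (k : ℝ≥0∞) ≠ 0 := by
        have : k ≠ 0 := by omega
        exact_mod_cast this
      simp [ENNReal.rpow_eq_zero_iff, this]
  push Not at htop
  set N : Fin k → ℝ≥0∞ := fun i => ∫⁻ t, h i t with hN
  -- The sum of the functions normalized to integral one dominates each of them, so the inequality
  -- for a single function, `lintegral_prod_lintegral_pow_le`, applies to it. Its integral k is the
  -- source of the constant.
  set F : (Fin k → ℝ) → ℝ≥0∞ := fun t => ∑ i, (N i)⁻¹ * h i t with hF
  have hFm : Measurable F := Finset.measurable_fun_sum _ fun i _ => (hm i).const_mul _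
  have hconj : Real.HolderConjugate (Fintype.card (Fin k)) ((k : ℝ) / (k - 1)) := by
    rw [Fintype.card_fin, Real.holderConjugate_iff]
    refine ⟨by linarith, ?_⟩
    field_simp
    ring
  have key := lintegral_prod_lintegral_pow_le (fun _ : Fin k => (volume : Measure ℝ)) hconj hFm
  rw [Fintype.card_fin] at key
  have hFint : ∫⁻ t, F t = k := by
    rw [hF, lintegral_finsetSum _ fun i _ => (hm i).const_mul _]
    have : ∀ i, ∫⁻ t, (N i)⁻¹ * h i t = 1 := fun i => by
      rw [lintegral_const_mul _ (hm i)]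
      exact ENNReal.inv_mul_cancel (hz i) (htop i)
    simp [this]
  rw [← volume_pi, hFint] at key
  have hcancel : ∀ i, N i * (N i)⁻¹ = 1 := fun i => ENNReal.mul_inv_cancel (hz i) (htop i)
  have hle : ∀ i t, ∫⁻ x, h i (Function.update t i x) ≤
      N i * ∫⁻ x, F (Function.update t i x) := by
    intro i t
    rw [← lintegral_const_mul' _ _ (htop i)]
    refine lintegral_mono fun x => ?_
    calc h i (Function.update t i x) = N i * ((N i)⁻¹ * h i (Function.update t i x)) := by
          rw [← mul_assoc, hcancel, one_mul]
      _ ≤ _ := by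
          gcongr
          exact Finset.single_le_sum (f := fun j => (N j)⁻¹ * h j (Function.update t i x))
            (fun _ _ => zero_le) (Finset.mem_univ i)
  calc ∫⁻ t : Fin k → ℝ, ∏ i, (∫⁻ x, h i (Function.update t i x)) ^ (1 / ((k : ℝ) - 1))
      ≤ ∫⁻ t : Fin k → ℝ, (∏ i, N i ^ (1 / ((k : ℝ) - 1))) *
          ∏ i, (∫⁻ x, F (Function.update t i x)) ^ (1 / ((k : ℝ) - 1)) := by
        refine lintegral_mono fun t => ?_
        rw [← Finset.prod_mul_distrib]
        refine Finset.prod_le_prod' fun i _ => ?_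
        rw [← ENNReal.mul_rpow_of_nonneg _ _ hp.le]
        exact ENNReal.rpow_le_rpow (hle i t) hp.le
    _ = (∏ i, N i ^ (1 / ((k : ℝ) - 1))) *
          ∫⁻ t : Fin k → ℝ, ∏ i, (∫⁻ x, F (Function.update t i x)) ^ (1 / ((k : ℝ) - 1)) := by
        rw [lintegral_const_mul']
        exact ENNReal.prod_ne_top fun i _ => ENNReal.rpow_ne_top_of_nonneg hp.le (htop i)
    _ ≤ _ := by
        rw [mul_comm]
        gcongr

theorem measurable_sumElim {α β : Type} :
    Measurable fun p : (α → ℝ) × (β → ℝ) => (Sum.elim p.1 p.2 : α ⊕ β → ℝ) := by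
  refine measurable_pi_lambda _ fun j => ?_
  cases j <;> simp only [Sum.elim_inl, Sum.elim_inr] <;> fun_prop

theorem lintegral_box_sum {α β : Type} [Fintype α] [Fintype β] (r : ℝ)
    {H : (α ⊕ β → ℝ) → ℝ≥0∞} (hH : Measurable H) :
    ∫⁻ τ in box (α ⊕ β) r, H τ =
      ∫⁻ z in box β r, ∫⁻ t in box α r, H (Sum.elim t z) := by
  have hmp := volume_measurePreserving_sumPiEquivProdPi_symm (fun _ : α ⊕ β => ℝ)
  have he : ∀ p, (MeasurableEquiv.sumPiEquivProdPi (fun _ : α ⊕ β => ℝ)).symm p =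
      Sum.elim p.1 p.2 := fun p => by
    funext j; cases j <;> rfl
  have hpre : (MeasurableEquiv.sumPiEquivProdPi (fun _ : α ⊕ β => ℝ)).symm ⁻¹' box (α ⊕ β) r =
      box α r ×ˢ box β r := by
    ext p
    simp only [mem_preimage, he, mem_box, mem_prod, Sum.forall, Sum.elim_inl, Sum.elim_inr]
  rw [← hmp.setLIntegral_comp_preimage (measurableSet_box _ _) hH, hpre]
  simp only [he]
  rw [Measure.volume_eq_prod, ← Measure.prod_restrict,
    lintegral_prod_symm' (fun p => H (Sum.elim p.1 p.2)) (hH.comp measurable_sumElim)]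

theorem lintegral_box_sum' {α β : Type} [Fintype α] [Fintype β] (r : ℝ)
    {H : (α ⊕ β → ℝ) → ℝ≥0∞} (hH : Measurable H) :
    ∫⁻ τ in box (α ⊕ β) r, H τ =
      ∫⁻ t in box α r, ∫⁻ z in box β r, H (Sum.elim t z) := by
  rw [lintegral_box_sum r hH, lintegral_lintegral_swap]
  exact (hH.comp (measurable_sumElim.comp measurable_swap)).aemeasurable

theorem update_mem_box {α : Type} [DecidableEq α] {r : ℝ} {t : α → ℝ} (ht : t ∈ box α r) (i : α)
    {x : ℝ} : Function.update t i x ∈ box α r ↔ x ∈ Icc (-r) r := by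
  rw [mem_box, mem_Icc, ← abs_le]
  constructor
  · intro h
    simpa using h i
  · intro h j
    by_cases hj : j = i
    · subst hj; simpa using h
    · simpa [hj] using mem_box.1 ht j

theorem lintegral_indicator_box_update {α : Type} [Fintype α] [DecidableEq α] {r : ℝ} {t : α → ℝ}
    (ht : t ∈ box α r) (i : α) (A : (α → ℝ) → ℝ≥0∞) :
    ∫⁻ x, (box α r).indicator A (Function.update t i x) =
      ∫⁻ x in Icc (-r) r, A (Function.update t i x) := by
  rw [← lintegral_indicator measurableSet_Icc]
  refine lintegral_congr fun x => ?_
  by_cases hx : x ∈ Icc (-r) r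
  · rw [indicator_of_mem hx, indicator_of_mem ((update_mem_box ht i).2 hx)]
  · rw [indicator_of_notMem hx, indicator_of_notMem (mt (update_mem_box ht i).1 hx)]

/-- A Loomis–Whitney inequality for functions that are essentially constant at scale `ρ` in one of
the first `k` directions each, one of them being moreover essentially constant at scale `ℓ` in the
remaining `d` directions. -/
theorem lintegral_box_prod_rpow_le {k d : ℕ} (hk : 2 ≤ k) (i₁ : Fin k) {ρ ℓ : ℝ} (hρ : 0 < ρ)
    (hℓ : 0 < ℓ) (hℓρ : ℓ ≤ ρ) {F g : Fin k → (Fin k ⊕ Fin d → ℝ) → ℝ≥0∞}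
    (hF : ∀ i, Measurable (F i)) (hg : ∀ i, Measurable (g i)) {K : ℝ≥0∞} (hK : K ≠ ⊤)
    (hFg : ∀ i, ∀ τ y, |y (Sum.inl i)| ≤ 2 * ρ → (∀ j ≠ i, y (Sum.inl j) = 0) →
      (∀ l, |y (Sum.inr l)| ≤ if i = i₁ then ℓ else 0) → F i τ ≤ K * g i (τ + y)) :
    ∫⁻ τ in box (Fin k ⊕ Fin d) ρ, ∏ i, F i τ ^ (1 / ((k : ℝ) - 1)) ≤
      (∏ i : Fin k, (K * (ENNReal.ofReal (2 * ρ) *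
        if i = i₁ then ENNReal.ofReal (2 * ℓ) ^ d else 1)⁻¹) ^ (1 / ((k : ℝ) - 1))) *
      (k : ℝ≥0∞) ^ ((k : ℝ) / (k - 1)) *
        ∏ i, (∫⁻ τ in box (Fin k ⊕ Fin d) (2 * ρ), g i τ) ^ (1 / ((k : ℝ) - 1)) := by
  have hk1 : (0 : ℝ) < (k : ℝ) - 1 := by
    have : (2 : ℝ) ≤ k := by exact_mod_cast hk
    linarith
  set p : ℝ := 1 / ((k : ℝ) - 1) with hpdef
  have hp : 0 < p := by positivity
  set c : Fin k → ℝ≥0∞ := fun i => ENNReal.ofReal (2 * ρ) *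
    if i = i₁ then ENNReal.ofReal (2 * ℓ) ^ d else 1 with hc
  have hc0 : ∀ i, c i ≠ 0 := fun i => by
    have h1 : ENNReal.ofReal (2 * ρ) ≠ 0 := by simpa using hρ
    have h2 : ENNReal.ofReal (2 * ℓ) ≠ 0 := by simpa using hℓ
    simp only [hc]
    split_ifs
    · exact mul_ne_zero h1 (pow_ne_zero _ h2)
    · exact mul_ne_zero h1 one_ne_zero
  have hct : ∀ i, c i ≠ ⊤ := fun i => by
    simp only [hc]
    split_ifs
    · exact ENNReal.mul_ne_top ENNReal.ofReal_ne_top (ENNReal.pow_ne_top ENNReal.ofReal_ne_top)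
    · exact ENNReal.mul_ne_top ENNReal.ofReal_ne_top ENNReal.one_ne_top
  -- the function attached to the index `i`, frozen at the last coordinates `z`
  set A : Fin k → (Fin d → ℝ) → (Fin k → ℝ) → ℝ≥0∞ := fun i z t =>
    if i = i₁ then ∫⁻ z' in box (Fin d) (2 * ρ), g i (Sum.elim t z') else g i (Sum.elim t z) with hA
  have hgm : ∀ i, Measurable fun q : (Fin k → ℝ) × (Fin d → ℝ) => g i (Sum.elim q.1 q.2) :=
    fun i => (hg i).comp measurable_sumElim
  have hAm : ∀ i, Measurable fun q : (Fin k → ℝ) × (Fin d → ℝ) => A i q.2 q.1 := by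
    intro i
    simp only [hA]
    split_ifs
    · exact (Measurable.lintegral_prod_right' (ν := volume.restrict (box (Fin d) (2 * ρ)))
        (hgm i)).comp measurable_fst
    · exact hgm i
  have hAm1 : ∀ i z, Measurable (A i z) := fun i z =>
    (hAm i).comp (measurable_id.prodMk measurable_const)
  -- Average over the admissible shifts: the i-th coordinate runs over an interval of length 2ρ and,
  -- for i₁, the last coordinates run over a cube of side 2ℓ. The measure of this set of shifts is
  -- `c i`.
  have hFA : ∀ i, ∀ z ∈ box (Fin d) ρ, ∀ t ∈ box (Fin k) ρ, F i (Sum.elim t z) ≤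
      K * (c i)⁻¹ * ∫⁻ x, (box (Fin k) ρ).indicator (A i z) (Function.update t i x) := by
    intro i z hz t ht
    have hmain : c i * F i (Sum.elim t z) ≤
        K * ∫⁻ x in Icc (-ρ) ρ, A i z (Function.update t i x) := by
      have hshift : ∀ x ∈ Icc (-ρ) ρ, ∀ z' : Fin d → ℝ, (∀ l, |z' l - z l| ≤ if i = i₁ then ℓ else 0) →
          F i (Sum.elim t z) ≤ K * g i (Sum.elim (Function.update t i x) z') := by
        intro x hx z' hz'
        convert hFg i (Sum.elim t z) (Sum.elim (Function.update t i x) z' - Sum.elim t z) ?_ ?_ ?_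
          using 3
        · abel
        · have h1 := abs_le.1 (mem_box.1 ht i)
          simp only [Pi.sub_apply, Sum.elim_inl, Function.update_self]
          rw [abs_le]
          constructor <;> linarith [hx.1, hx.2]
        · intro j hj
          rw [Pi.sub_apply, Sum.elim_inl, Sum.elim_inl, Function.update_of_ne hj, sub_self]
        · intro l
          rw [Pi.sub_apply, Sum.elim_inr, Sum.elim_inr]
          exact hz' l
      rw [← lintegral_const_mul' _ _ hK]
      have hvol : ∀ a : ℝ≥0∞, ENNReal.ofReal (2 * ρ) * a = ∫⁻ _ in Icc (-ρ) ρ, a := fun a => by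
        rw [setLIntegral_const, Real.volume_Icc, mul_comm]
        ring_nf
      simp only [hc]
      rw [mul_assoc, hvol]
      refine setLIntegral_mono' measurableSet_Icc fun x hx => ?_
      by_cases hi : i = i₁
      · simp only [hA, hi, if_true]
        subst hi
        have hvol2 : ENNReal.ofReal (2 * ℓ) ^ d * F i (Sum.elim t z) =
            ∫⁻ _ in {z' : Fin d → ℝ | ∀ l, |z' l - z l| ≤ ℓ}, F i (Sum.elim t z) := by
          rw [setLIntegral_const, mul_comm]
          congr 1
          have : {z' : Fin d → ℝ | ∀ l, |z' l - z l| ≤ ℓ} =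
              Set.pi univ fun l => Icc (z l - ℓ) (z l + ℓ) := by
            ext z'
            simp only [mem_ofPred_eq, mem_univ_pi, mem_Icc, abs_le]
            exact forall_congr' fun l => by constructor <;> rintro ⟨_, _⟩ <;> constructor <;> linarith
          rw [this, volume_pi, Measure.pi_pi]
          have hv : ∀ l, volume (Icc (z l - ℓ) (z l + ℓ)) = ENNReal.ofReal (2 * ℓ) := fun l => by
            rw [Real.volume_Icc]
            ring_nf
          simp only [hv, Finset.prod_const, Finset.card_univ, Fintype.card_fin]
        rw [hvol2, ← lintegral_const_mul' _ _ hK]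
        have hsub : {z' : Fin d → ℝ | ∀ l, |z' l - z l| ≤ ℓ} ⊆ box (Fin d) (2 * ρ) := by
          intro z' hz'
          rw [mem_box]
          intro l
          have h1 := abs_le.1 (hz' l)
          have h2 := abs_le.1 (mem_box.1 hz l)
          rw [abs_le]
          constructor <;> linarith
        have hms : MeasurableSet {z' : Fin d → ℝ | ∀ l, |z' l - z l| ≤ ℓ} := by
          rw [ofPred_forall]
          exact MeasurableSet.iInter fun l => measurableSet_le (by fun_prop) measurable_const
        refine le_trans ?_ (lintegral_mono_set hsub)
        refine setLIntegral_mono' hms fun z' hz' => ?_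
        refine hshift x hx z' fun l => ?_
        rw [if_pos rfl]
        exact hz' l
      · simp only [hA, hi, if_false, one_mul]
        exact hshift x hx z fun l => by simp [hi]
    rw [lintegral_indicator_box_update ht i]
    calc F i (Sum.elim t z) = (c i)⁻¹ * (c i * F i (Sum.elim t z)) := by
          rw [← mul_assoc, ENNReal.inv_mul_cancel (hc0 i) (hct i), one_mul]
      _ ≤ (c i)⁻¹ * (K * ∫⁻ x in Icc (-ρ) ρ, A i z (Function.update t i x)) := by gcongr
      _ = _ := by ring
  have hKc : ∏ i : Fin k, (K * (c i)⁻¹) ^ p ≠ ⊤ := ENNReal.prod_ne_top fun i _ =>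
    ENNReal.rpow_ne_top_of_nonneg hp.le (ENNReal.mul_ne_top hK (ENNReal.inv_ne_top.2 (hc0 i)))
  set I : Fin k → (Fin d → ℝ) → ℝ≥0∞ := fun i z => ∫⁻ t in box (Fin k) ρ, A i z t with hI
  have hIm : ∀ i, Measurable (I i) := fun i =>
    Measurable.lintegral_prod_left' (μ := volume.restrict (box (Fin k) ρ)) (hAm i)
  have step1 : ∀ z ∈ box (Fin d) ρ, ∫⁻ t in box (Fin k) ρ, ∏ i, F i (Sum.elim t z) ^ p ≤
      (∏ i : Fin k, (K * (c i)⁻¹) ^ p) * ((k : ℝ≥0∞) ^ ((k : ℝ) / (k - 1)) * ∏ i, I i z ^ p) := by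
    intro z hz
    calc ∫⁻ t in box (Fin k) ρ, ∏ i, F i (Sum.elim t z) ^ p
        ≤ ∫⁻ t in box (Fin k) ρ, (∏ i : Fin k, (K * (c i)⁻¹) ^ p) *
          ∏ i, (∫⁻ x, (box (Fin k) ρ).indicator (A i z) (Function.update t i x)) ^ p := by
          refine setLIntegral_mono' (measurableSet_box _ _) fun t ht => ?_
          rw [← Finset.prod_mul_distrib]
          refine Finset.prod_le_prod' fun i _ => ?_
          rw [← ENNReal.mul_rpow_of_nonneg _ _ hp.le]
          exact ENNReal.rpow_le_rpow (hFA i z hz t ht) hp.le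
      _ ≤ (∏ i : Fin k, (K * (c i)⁻¹) ^ p) * ∫⁻ t,
          ∏ i, (∫⁻ x, (box (Fin k) ρ).indicator (A i z) (Function.update t i x)) ^ p := by
          rw [lintegral_const_mul' _ _ hKc]
          gcongr
          exact Measure.restrict_le_self
      _ ≤ _ := by
          gcongr
          refine (lintegral_prod_lintegral_update_le hk fun i =>
            (hAm1 i z).indicator (measurableSet_box _ _)).trans_eq ?_
          simp only [lintegral_indicator (measurableSet_box _ _), hI, ← hpdef]
  -- For i₁ the last variables have been integrated out, so the bound is uniform in z. The other k -
  -- 1 factors are left for Hölder in z with exponents 1/(k-1), which sum to one.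
  have hIi₁ : ∀ z, I i₁ z ≤ ∫⁻ τ in box (Fin k ⊕ Fin d) (2 * ρ), g i₁ τ := by
    intro z
    simp only [hI, hA, if_true]
    rw [lintegral_box_sum' _ (hg i₁)]
    exact lintegral_mono_set (box_mono _ (by linarith))
  have hIi : ∀ i ≠ i₁, ∫⁻ z in box (Fin d) ρ, I i z ≤
      ∫⁻ τ in box (Fin k ⊕ Fin d) (2 * ρ), g i τ := by
    intro i hi
    simp only [hI, hA, hi, if_false]
    rw [← lintegral_box_sum _ (hg i)]
    exact lintegral_mono_set (box_mono _ (by linarith))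
  have hsum : ∑ _i ∈ Finset.univ.erase i₁, p = 1 := by
    rw [Finset.sum_const, Finset.card_erase_of_mem (Finset.mem_univ _), Finset.card_univ,
      Fintype.card_fin, nsmul_eq_mul, Nat.cast_sub (by omega), Nat.cast_one, hpdef]
    field_simp
  have hHm : Measurable fun τ => ∏ i, F i τ ^ p :=
    Finset.measurable_fun_prod _ fun i _ => (hF i).pow_const p
  rw [lintegral_box_sum _ hHm]
  calc ∫⁻ z in box (Fin d) ρ, ∫⁻ t in box (Fin k) ρ, ∏ i, F i (Sum.elim t z) ^ p
      ≤ ∫⁻ z in box (Fin d) ρ, (∏ i : Fin k, (K * (c i)⁻¹) ^ p) *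
        ((k : ℝ≥0∞) ^ ((k : ℝ) / (k - 1)) *
          ((∫⁻ τ in box (Fin k ⊕ Fin d) (2 * ρ), g i₁ τ) ^ p *
            ∏ i ∈ Finset.univ.erase i₁, I i z ^ p)) := by
        refine setLIntegral_mono' (measurableSet_box _ _) fun z hz => (step1 z hz).trans ?_
        rw [← Finset.mul_prod_erase Finset.univ (fun i => I i z ^ p) (Finset.mem_univ i₁)]
        gcongr
        exact hIi₁ z
    _ = (∏ i : Fin k, (K * (c i)⁻¹) ^ p) *
        ((k : ℝ≥0∞) ^ ((k : ℝ) / (k - 1)) *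
          ((∫⁻ τ in box (Fin k ⊕ Fin d) (2 * ρ), g i₁ τ) ^ p *
            ∫⁻ z in box (Fin d) ρ, ∏ i ∈ Finset.univ.erase i₁, I i z ^ p)) := by
        have hm : Measurable fun z => ∏ i ∈ Finset.univ.erase i₁, I i z ^ p :=
          Finset.measurable_fun_prod _ fun i _ => (hIm i).pow_const p
        rw [lintegral_const_mul _ ((hm.const_mul _).const_mul _),
          lintegral_const_mul _ (hm.const_mul _), lintegral_const_mul _ hm]
    _ ≤ (∏ i : Fin k, (K * (c i)⁻¹) ^ p) *
        ((k : ℝ≥0∞) ^ ((k : ℝ) / (k - 1)) *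
          ((∫⁻ τ in box (Fin k ⊕ Fin d) (2 * ρ), g i₁ τ) ^ p *
            ∏ i ∈ Finset.univ.erase i₁, (∫⁻ τ in box (Fin k ⊕ Fin d) (2 * ρ), g i τ) ^ p)) := by
        gcongr
        refine (ENNReal.lintegral_prod_norm_pow_le _ (fun i _ => (hIm i).aemeasurable) hsum
          fun _ _ => hp.le).trans ?_
        refine Finset.prod_le_prod' fun i hi => ?_
        exact ENNReal.rpow_le_rpow (hIi i (Finset.ne_of_mem_erase hi)) hp.le
    _ = _ := by
        rw [Finset.mul_prod_erase _ (fun i => (∫⁻ τ in box (Fin k ⊕ Fin d) (2 * ρ), g i τ) ^ p)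
          (Finset.mem_univ i₁)]
        ring

/-! ### The induction on scales -/

section
variable {X J ι : Type} [MeasurableSpace X] [Fintype J] {ν : Measure X} {s : X → J → ℝ}

theorem measurable_squareFn [Countable ι] (hs : Measurable s) (r : ℝ) {f : ι → X → ℂ}
    (hf : ∀ i, Integrable (f i) ν) : Measurable (squareFn ν s r f) := by
  unfold squareFn
  refine Measurable.tsum fun i => Measurable.tsum fun θ => ?_
  refine Measurable.pow_const (Measurable.enorm (Continuous.measurable ?_)) 2
  refine continuous_of_dominated (bound := fun ξ => ‖f i ξ‖) (fun c => ?_) (fun c => ?_)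
    (hf i).norm.integrableOn ?_
  · exact (integrable_expo_mul hs c (hf i)).integrableOn.aestronglyMeasurable
  · exact Eventually.of_forall fun ξ => by rw [norm_mul, norm_expo, one_mul]
  · exact Eventually.of_forall fun ξ =>
      (continuous_expo.comp (Continuous.prodMk_left _)).mul continuous_const

theorem enorm_integral_sq_le (g : X → ℂ) (hg : AEStronglyMeasurable g ν) :
    ‖∫ ξ, g ξ ∂ν‖ₑ ^ 2 ≤ ν univ * ∫⁻ ξ, ‖g ξ‖ₑ ^ 2 ∂ν := by
  have h := ENNReal.lintegral_mul_le_Lp_mul_Lq ν (p := 2) (q := 2) Real.HolderConjugate.two_two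
    (f := fun _ => 1) (g := fun ξ => ‖g ξ‖ₑ) aemeasurable_const hg.enorm
  calc ‖∫ ξ, g ξ ∂ν‖ₑ ^ 2 ≤ (∫⁻ ξ, ‖g ξ‖ₑ ∂ν) ^ 2 := by
        gcongr
        exact enorm_integral_le_lintegral_enorm _
    _ ≤ ((ν univ) ^ (1 / 2 : ℝ) * (∫⁻ ξ, ‖g ξ‖ₑ ^ (2 : ℝ) ∂ν) ^ (1 / 2 : ℝ)) ^ 2 := by
        gcongr
        simpa using h
    _ = _ := by
        rw [mul_pow, ← ENNReal.rpow_natCast, ← ENNReal.rpow_natCast, ← ENNReal.rpow_mul,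
          ← ENNReal.rpow_mul]
        norm_num

/-- Cauchy–Schwarz on each of the disjoint cells. This ends the induction at the largest scale. -/
theorem squareFn_le_mul_sqNorm (hs : Measurable s) {r : ℝ} {v : ℝ≥0∞}
    (hv : ∀ θ, ν (cellSet s r θ) ≤ v) {f : ι → X → ℂ} (hf : ∀ i, Integrable (f i) ν) (c : J → ℝ) :
    squareFn ν s r f c ≤ v * sqNorm ν f := by
  unfold squareFn sqNorm
  rw [← ENNReal.tsum_mul_left]
  refine ENNReal.tsum_le_tsum fun i => ?_
  calc ∑' θ, ‖∫ ξ in cellSet s r θ, expo c (s ξ) * f i ξ ∂ν‖ₑ ^ 2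
      ≤ ∑' θ, v * ∫⁻ ξ in cellSet s r θ, ‖f i ξ‖ₑ ^ 2 ∂ν := by
        refine ENNReal.tsum_le_tsum fun θ => ?_
        refine (enorm_integral_sq_le _
          (integrable_expo_mul hs c (hf i)).integrableOn.aestronglyMeasurable).trans ?_
        rw [Measure.restrict_apply_univ]
        simp only [enorm_mul, enorm_expo, one_mul]
        gcongr
        exact hv θ
    _ = v * ∫⁻ ξ in ⋃ θ, cellSet s r θ, ‖f i ξ‖ₑ ^ 2 ∂ν := by
        rw [ENNReal.tsum_mul_left, lintegral_iUnion (measurableSet_cellSet r hs)]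
        intro θ θ' hne
        exact Disjoint.preimage _ (by simpa using hne)
    _ ≤ _ := by
        gcongr
        exact Measure.restrict_le_self

/-- This starts the induction: bounded coordinates meet finitely many cells, and Cauchy–Schwarz
costs their number, which is harmless at scale one. -/
theorem enorm_integral_expo_sq_le_squareFn [DecidableEq J] {B : ℝ} (hB : ∀ ξ j, |s ξ j| ≤ B)
    {r : ℝ} (hr : 0 < r) (hs : Measurable s) {f : X → ℂ} (hf : Integrable f ν) (c : J → ℝ) :
    ‖∫ ξ, expo c (s ξ) * f ξ ∂ν‖ₑ ^ 2 ≤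
      (Fintype.piFinset fun _ : J => Finset.Icc ⌊-(r * B)⌋ ⌊r * B⌋).card *
        squareFn ν s r (fun _ : Unit => f) c := by
  rw [integral_eq_sum_cellSet hB hr hs (integrable_expo_mul hs c hf)]
  set T := Fintype.piFinset fun _ : J => Finset.Icc ⌊-(r * B)⌋ ⌊r * B⌋
  set b : (J → ℤ) → ℂ := fun θ => ∫ ξ in cellSet s r θ, expo c (s ξ) * f ξ ∂ν
  have h1 := ENNReal.rpow_sum_le_const_mul_sum_rpow T (fun θ => ‖b θ‖ₑ) (p := 2) (by norm_num)
  norm_num at h1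
  calc ‖∑ θ ∈ T, b θ‖ₑ ^ 2 ≤ (∑ θ ∈ T, ‖b θ‖ₑ) ^ 2 := by
        gcongr
        exact enorm_sum_le T b
    _ ≤ T.card * ∑ θ ∈ T, ‖b θ‖ₑ ^ 2 := h1
    _ ≤ _ := by
        gcongr
        simp only [squareFn, tsum_fintype, Finset.univ_unique, Finset.sum_singleton]
        exact ENNReal.sum_le_tsum T

/-- For each τ in the small box, the translate of the box of size b by -τ lies in the box of size b
+ r. This reduces a global integral to estimates on translates of one small box. -/
theorem volume_box_mul_lintegral_le {H : (J → ℝ) → ℝ≥0∞} (hH : Measurable H) (r b : ℝ) :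
    volume (box J r) * ∫⁻ c in box J b, H c ≤
      ∫⁻ c in box J (b + r), ∫⁻ τ in box J r, H (c + τ) := by
  rw [lintegral_lintegral_swap (by fun_prop)]
  rw [mul_comm, ← setLIntegral_const]
  refine setLIntegral_mono' (measurableSet_box _ _) fun τ hτ => ?_
  rw [← lintegral_indicator (measurableSet_box _ _), ← lintegral_indicator (measurableSet_box _ _),
    ← lintegral_add_right_eq_self _ τ]
  refine lintegral_mono fun c => ?_
  by_cases hc : c + τ ∈ box J b
  · rw [indicator_of_mem hc, indicator_of_mem]
    rw [mem_box] at *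
    intro j
    have h1 := abs_le.1 (hc j)
    have h2 := abs_le.1 (hτ j)
    rw [Pi.add_apply] at h1
    rw [abs_le]
    constructor <;> linarith
  · rw [indicator_of_notMem hc]
    exact zero_le

end

/-- The constant lost in one step of the induction on scales. -/
noncomputable def stepConst (k d : ℕ) : ℝ :=
  (Real.exp ((k + d) * 2 ^ 2) * Real.exp ((k + d) * 2 ^ 2) *
    Real.pi ^ (k + d)) ^ ((k : ℝ) / (k - 1)) * (k : ℝ) ^ ((k : ℝ) / (k - 1))

/-- The exponent of t is k(k+d-1) = (k-1)(k+d) + d. After the root, the first part is the volume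
t^(k+d) of a box of side t; the excess d pairs with L^(-d). -/
theorem prod_step_factor {k d : ℕ} (hk : 2 ≤ k) (i₁ : Fin k) {A t L : ℝ} (hA : 0 < A) (ht : 0 < t)
    (hL : 0 < L) :
    ∏ i : Fin k, (A * (t * if i = i₁ then L ^ d else 1)⁻¹ *
        (A * (Real.pi * t) ^ (k + d))) ^ (1 / ((k : ℝ) - 1)) =
      (A * A * Real.pi ^ (k + d)) ^ ((k : ℝ) / (k - 1)) * (t / L) ^ ((d : ℝ) / (k - 1)) *
        t ^ (k + d) := by
  have hk1 : (0 : ℝ) < (k : ℝ) - 1 := by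
    have : (2 : ℝ) ≤ k := by exact_mod_cast hk
    linarith
  have hpi := Real.pi_pos
  have hnn : ∀ i : Fin k, 0 ≤ A * (t * if i = i₁ then L ^ d else 1)⁻¹ *
      (A * (Real.pi * t) ^ (k + d)) := fun i => by split_ifs <;> positivity
  rw [Real.finsetProd_rpow _ _ fun i _ => hnn i]
  have h1 : ∏ i : Fin k, (A * (t * if i = i₁ then L ^ d else 1)⁻¹ *
      (A * (Real.pi * t) ^ (k + d))) =
      (A * A * Real.pi ^ (k + d)) ^ k * (t / L) ^ d * (t ^ (k + d)) ^ (k - 1) := by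
    have h2 : ∀ i : Fin k, A * (t * if i = i₁ then L ^ d else 1)⁻¹ * (A * (Real.pi * t) ^ (k + d)) =
        (A * A * Real.pi ^ (k + d)) * (t ^ (k + d) / t) * if i = i₁ then (L ^ d)⁻¹ else 1 := by
      intro i
      split_ifs <;> (rw [mul_pow]; field_simp)
    simp only [h2]
    rw [Finset.prod_mul_distrib, Finset.prod_ite_eq' Finset.univ i₁, if_pos (Finset.mem_univ _),
      Finset.prod_const, Finset.card_univ, Fintype.card_fin, mul_pow]
    obtain ⟨m, rfl⟩ : ∃ m, k = m + 1 := ⟨k - 1, by omega⟩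
    rw [Nat.add_sub_cancel, div_pow, div_pow, pow_succ (t ^ (m + 1 + d)) m, pow_add t (m + 1) d]
    field_simp
  rw [h1, Real.mul_rpow (by positivity) (by positivity), Real.mul_rpow (by positivity)
    (by positivity), ← Real.rpow_natCast (A * A * Real.pi ^ (k + d)), ← Real.rpow_mul
    (by positivity), ← Real.rpow_natCast (t / L), ← Real.rpow_mul (by positivity),
    ← Real.rpow_natCast (t ^ (k + d)), ← Real.rpow_mul (by positivity), Nat.cast_sub (by omega),
    Nat.cast_one, mul_one_div_cancel hk1.ne', Real.rpow_one, mul_one_div, mul_one_div]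

/-- On every translate of the box of size ρ, local constancy feeds Loomis–Whitney, and orthogonality
converts the resulting averages into square functions at scale ρ. Cells at scale r have width at
most a/ρ in their own direction and, for i₁, at most a/ℓ in the last ones. -/
theorem multilinear_step {k d : ℕ} (hk : 2 ≤ k) (i₁ : Fin k) {X : Type} [MeasurableSpace X]
    {ν : Fin k → Measure X} {s : Fin k → X → Fin k ⊕ Fin d → ℝ} (hs : ∀ i, Measurable (s i))
    {B : ℝ} (hB : ∀ i ξ j, |s i ξ j| ≤ B) {r ρ ℓ a : ℝ} (hr : 0 < r) (hrρ : r ≤ ρ) (hℓ : 0 < ℓ)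
    (hℓρ : ℓ ≤ ρ) (ha : 1 ≤ a)
    (hown : ∀ i ξ η, cell r (s i ξ) = cell r (s i η) →
      ρ * |s i ξ (Sum.inl i) - s i η (Sum.inl i)| ≤ a)
    (hsmall : ∀ ξ η, cell r (s i₁ ξ) = cell r (s i₁ η) → ∀ l,
      ℓ * |s i₁ ξ (Sum.inr l) - s i₁ η (Sum.inr l)| ≤ a)
    {ι : Type} [Countable ι] {f : Fin k → ι → X → ℂ} (hf : ∀ i j, Integrable (f i j) (ν i)) :
    ∃ (ι' : Type) (_ : Countable ι') (f' : Fin k → ι' → X → ℂ),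
      (∀ i j, Integrable (f' i j) (ν i)) ∧
      (∀ i, sqNorm (ν i) (f' i) ≤
        monomConst (Fin k ⊕ Fin d) 1 * monomConst (Fin k ⊕ Fin d) a * sqNorm (ν i) (f i)) ∧
      ∀ b : ℝ, ∫⁻ c in box (Fin k ⊕ Fin d) b,
          ∏ i, squareFn (ν i) (s i) r (f i) c ^ (1 / ((k : ℝ) - 1)) ≤
        ENNReal.ofReal (stepConst k d * (ρ / ℓ) ^ ((d : ℝ) / (k - 1))) *
          ∫⁻ c in box (Fin k ⊕ Fin d) (b + ρ),
            ∏ i, squareFn (ν i) (s i) ρ (f' i) c ^ (1 / ((k : ℝ) - 1)) := by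
  classical
  have hk1 : (0 : ℝ) < (k : ℝ) - 1 := by
    have : (2 : ℝ) ≤ k := by exact_mod_cast hk
    linarith
  have hρ : 0 < ρ := hr.trans_le hrρ
  have hp : 0 < 1 / ((k : ℝ) - 1) := by positivity
  have hpi := Real.pi_pos
  -- the lengths over which the square functions are essentially constant
  set lam : Fin k → Fin k ⊕ Fin d → ℝ := fun i => Sum.elim (fun j => if j = i then ρ else r)
    (fun _ => if i = i₁ then ℓ else r) with hlam
  have hlam0 : ∀ i j, 0 < lam i j := by
    rintro i (j | j) <;> simp only [hlam, Sum.elim_inl, Sum.elim_inr] <;> split_ifs <;> assumption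
  have hcellr : ∀ i ξ η, cell r (s i ξ) = cell r (s i η) → ∀ j, r * |s i ξ j - s i η j| ≤ a := by
    intro i ξ η h j
    have h1 : ⌊r * s i ξ j⌋ = ⌊r * s i η j⌋ := congrFun h j
    have h2 := Int.abs_sub_lt_one_of_floor_eq_floor h1
    rw [← mul_sub, abs_mul, abs_of_pos hr] at h2
    linarith
  have hcell : ∀ i ξ η, cell r (s i ξ) = cell r (s i η) → ∀ j, lam i j * |s i ξ j - s i η j| ≤ a := by
    rintro i ξ η h (j | j) <;> simp only [hlam, Sum.elim_inl, Sum.elim_inr] <;> split_ifs with hj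
    · subst hj; exact hown _ ξ η h
    · exact hcellr i ξ η h _
    · subst hj; exact hsmall ξ η h j
    · exact hcellr i ξ η h _
  -- A reference point in every cell that is met; the value 0 on the remaining cells is never used.
  set sbar : Fin k → (Fin k ⊕ Fin d → ℤ) → Fin k ⊕ Fin d → ℝ := fun i θ =>
    if h : ∃ η, cell r (s i η) = θ then s i h.choose else 0 with hsbar
  set u : Fin k → X → Fin k ⊕ Fin d → ℝ := fun i ξ j =>
    lam i j * (s i ξ j - sbar i (cell r (s i ξ)) j) with hu
  have hum : ∀ i, Measurable (u i) := fun i => by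
    refine measurable_pi_lambda _ fun j => ?_
    have h1 : Measurable fun ξ => sbar i (cell r (s i ξ)) j := (Measurable.of_discrete
      (f := fun θ => sbar i θ j)).comp (measurable_cell r (hs i))
    exact ((measurable_pi_iff.1 (hs i) j).sub h1).const_mul _
  have hua : ∀ i ξ j, |u i ξ j| ≤ a := by
    intro i ξ j
    have hex : ∃ η, cell r (s i η) = cell r (s i ξ) := ⟨ξ, rfl⟩
    simp only [hu, hsbar, dif_pos hex]
    rw [abs_mul, abs_of_pos (hlam0 i j)]
    exact hcell i _ _ hex.choose_spec.symm j
  set v : Fin k → X → Fin k ⊕ Fin d → ℝ := fun i ξ j => ρ * s i ξ j - cell ρ (s i ξ) j with hv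
  have hvm : ∀ i, Measurable (v i) := fun i => by
    refine measurable_pi_lambda _ fun j => ?_
    have h1 : Measurable fun ξ => ((cell ρ (s i ξ) j : ℤ) : ℝ) := (Measurable.of_discrete
      (f := fun θ : Fin k ⊕ Fin d → ℤ => ((θ j : ℤ) : ℝ))).comp (measurable_cell ρ (hs i))
    exact ((measurable_pi_iff.1 (hs i) j).const_mul _).sub h1
  have hva : ∀ i ξ j, |v i ξ j| ≤ 1 := fun i ξ j => by
    simp only [hv, cell]
    rw [abs_of_nonneg (sub_nonneg.2 (Int.floor_le _))]
    linarith [Int.lt_floor_add_one (ρ * s i ξ j)]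
  set g : Fin k → ι × Words (Fin k ⊕ Fin d) → X → ℂ := fun i => twist (u i) (f i) with hg
  have hgi : ∀ i j, Integrable (g i j) (ν i) := fun i => integrable_twist (hum i) (hua i) (hf i)
  have hgc : ∀ i j, Integrable (cut (s i) r (g i) j) (ν i) := fun i =>
    integrable_cut r (hs i) (hgi i)
  set f' : Fin k → ((ι × Words (Fin k ⊕ Fin d)) × (Fin k ⊕ Fin d → ℤ)) × Words (Fin k ⊕ Fin d) →
    X → ℂ := fun i => twist (v i) (cut (s i) r (g i)) with hf'
  have hfi' : ∀ i j, Integrable (f' i j) (ν i) := fun i =>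
    integrable_twist (hvm i) (hva i) (hgc i)
  refine ⟨_, inferInstance, f', hfi', fun i => ?_, fun b => ?_⟩
  · refine (sqNorm_twist_le (hvm i) (hva i) (hgc i)).trans ?_
    rw [mul_assoc]
    gcongr
    exact (sqNorm_cut_le r (hs i) _).trans (sqNorm_twist_le (hum i) (hua i) (hf i))
  set A : ℝ := Real.exp ((k + d) * 2 ^ 2) with hA
  have hA0 : 0 < A := Real.exp_pos _
  have hKA : monomConst (Fin k ⊕ Fin d) 2 = ENNReal.ofReal A := by
    simp [monomConst, hA]
  have hsqm : ∀ i, Measurable (squareFn (ν i) (s i) r (f i)) := fun i =>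
    measurable_squareFn (hs i) r (hf i)
  have hsqm' : ∀ i, Measurable (squareFn (ν i) (s i) r (g i)) := fun i =>
    measurable_squareFn (hs i) r (hgi i)
  -- The factor (2ρ)^(k+d) is the volume of the box and cancels when this is averaged over c.
  have hloc : ∀ c : Fin k ⊕ Fin d → ℝ, ∫⁻ τ in box (Fin k ⊕ Fin d) ρ,
      ∏ i, squareFn (ν i) (s i) r (f i) (c + τ) ^ (1 / ((k : ℝ) - 1)) ≤
      ENNReal.ofReal (stepConst k d * (ρ / ℓ) ^ ((d : ℝ) / (k - 1))) *
        ENNReal.ofReal (2 * ρ) ^ (k + d) *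
        ∏ i, squareFn (ν i) (s i) ρ (f' i) c ^ (1 / ((k : ℝ) - 1)) := by
    intro c
    refine (lintegral_box_prod_rpow_le hk i₁ hρ hℓ hℓρ
      (F := fun i τ => squareFn (ν i) (s i) r (f i) (c + τ))
      (g := fun i τ => squareFn (ν i) (s i) r (g i) (c + τ))
      (fun i => (hsqm i).comp (measurable_const_add c))
      (fun i => (hsqm' i).comp (measurable_const_add c)) (K := ENNReal.ofReal A)
      ENNReal.ofReal_ne_top ?_).trans ?_
    · intro i τ y h1 h2 h3
      have := squareFn_add_le (r := r) (hs i) (hf i) (hlam0 i) (sbar := sbar i) (u := u i)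
        (fun ξ j => rfl) (hua i) (y := -y) (b := 2) ?_ (c + (τ + y))
      · rw [hKA] at this
        convert this using 2
        abel
      · rintro (j | j)
        · rw [Pi.neg_apply, abs_neg]
          simp only [hlam, Sum.elim_inl]
          split_ifs with hj
          · subst hj; exact h1
          · rw [h2 j hj]; simp [hr.le]
        · rw [Pi.neg_apply, abs_neg]
          refine (h3 j).trans ?_
          simp only [hlam, Sum.elim_inr]
          split_ifs <;> linarith
    have hLS : ∀ i, ∫⁻ τ in box (Fin k ⊕ Fin d) (2 * ρ), squareFn (ν i) (s i) r (g i) (c + τ) ≤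
        ENNReal.ofReal (A * (Real.pi * (2 * ρ)) ^ (k + d)) * squareFn (ν i) (s i) ρ (f' i) c := by
      intro i
      refine (lintegral_squareFn_le (hB i) (r₀ := r) hρ (hs i) (hgi i) (u := v i)
        (fun ξ j => rfl) c).trans_eq ?_
      rw [hKA, ← ENNReal.ofReal_pow (by positivity), ← ENNReal.ofReal_mul (by positivity)]
      simp only [Fintype.card_sum, Fintype.card_fin, hf', mul_left_comm 2 Real.pi ρ]
    calc _ ≤ (∏ i : Fin k, (ENNReal.ofReal A * (ENNReal.ofReal (2 * ρ) *
          if i = i₁ then ENNReal.ofReal (2 * ℓ) ^ d else 1)⁻¹) ^ (1 / ((k : ℝ) - 1))) *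
          (k : ℝ≥0∞) ^ ((k : ℝ) / (k - 1)) *
          ∏ i, (ENNReal.ofReal (A * (Real.pi * (2 * ρ)) ^ (k + d)) *
            squareFn (ν i) (s i) ρ (f' i) c) ^ (1 / ((k : ℝ) - 1)) := by
          gcongr with i
          exact hLS i
      _ = (∏ i : Fin k, (ENNReal.ofReal (A * (2 * ρ * if i = i₁ then (2 * ℓ) ^ d else 1)⁻¹ *
            (A * (Real.pi * (2 * ρ)) ^ (k + d))) ^ (1 / ((k : ℝ) - 1)))) *
          (k : ℝ≥0∞) ^ ((k : ℝ) / (k - 1)) *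
          ∏ i, squareFn (ν i) (s i) ρ (f' i) c ^ (1 / ((k : ℝ) - 1)) := by
          simp only [ENNReal.mul_rpow_of_nonneg _ _ hp.le, Finset.prod_mul_distrib]
          have h4 : ∀ i : Fin k, ENNReal.ofReal (A * (2 * ρ * if i = i₁ then (2 * ℓ) ^ d else 1)⁻¹ *
              (A * (Real.pi * (2 * ρ)) ^ (k + d))) = ENNReal.ofReal A * (ENNReal.ofReal (2 * ρ) *
              if i = i₁ then ENNReal.ofReal (2 * ℓ) ^ d else 1)⁻¹ *
              ENNReal.ofReal (A * (Real.pi * (2 * ρ)) ^ (k + d)) := by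
            intro i
            have : 0 < 2 * ρ * if i = i₁ then (2 * ℓ) ^ d else 1 := by split_ifs <;> positivity
            rw [ENNReal.ofReal_mul (by positivity), ENNReal.ofReal_mul hA0.le,
              ENNReal.ofReal_inv_of_pos this, ENNReal.ofReal_mul (by positivity)]
            congr 4
            split_ifs
            · rw [ENNReal.ofReal_pow (by positivity)]
            · simp
          simp only [h4, ENNReal.mul_rpow_of_nonneg _ _ hp.le, Finset.prod_mul_distrib]
          ring
      _ = _ := by
          have hnn : ∀ i : Fin k, 0 ≤ A * (2 * ρ * if i = i₁ then (2 * ℓ) ^ d else 1)⁻¹ *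
            (A * (Real.pi * (2 * ρ)) ^ (k + d)) := fun i => by split_ifs <;> positivity
          simp only [fun i => ENNReal.ofReal_rpow_of_nonneg (hnn i) hp.le]
          rw [← ENNReal.ofReal_prod_of_nonneg fun i _ => Real.rpow_nonneg (hnn i) _,
            prod_step_factor hk i₁ hA0 (by positivity) (by positivity)]
          have hkk : (k : ℝ≥0∞) ^ ((k : ℝ) / (k - 1)) =
              ENNReal.ofReal ((k : ℝ) ^ ((k : ℝ) / (k - 1))) := by
            rw [← ENNReal.ofReal_rpow_of_nonneg (by positivity) (by positivity),
              ENNReal.ofReal_natCast]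
          rw [hkk, ← ENNReal.ofReal_pow (by positivity), ← ENNReal.ofReal_mul (by positivity),
            ← ENNReal.ofReal_mul (by unfold stepConst; positivity)]
          congr 2
          rw [stepConst, mul_div_mul_left _ _ two_ne_zero]
          ring
  have hHm : Measurable fun c => ∏ i, squareFn (ν i) (s i) r (f i) c ^ (1 / ((k : ℝ) - 1)) :=
    Finset.measurable_fun_prod _ fun i _ => (hsqm i).pow_const _
  have hvol0 : ENNReal.ofReal (2 * ρ) ^ (k + d) ≠ 0 := pow_ne_zero _ (by simpa using hρ)
  have hvolt : ENNReal.ofReal (2 * ρ) ^ (k + d) ≠ ⊤ := ENNReal.pow_ne_top ENNReal.ofReal_ne_top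
  have hglob := volume_box_mul_lintegral_le hHm ρ b
  rw [volume_box, Fintype.card_sum, Fintype.card_fin, Fintype.card_fin] at hglob
  rw [← ENNReal.mul_le_mul_iff_right hvol0 hvolt]
  refine hglob.trans ((lintegral_mono fun c => hloc c).trans_eq ?_)
  rw [lintegral_const_mul' _ _ (ENNReal.mul_ne_top ENNReal.ofReal_ne_top hvolt)]
  ring

theorem abs_sub_le_of_cell_eq {J : Type} {r : ℝ} (hr : 0 < r) {s s' : J → ℝ}
    (h : cell r s = cell r s') (j : J) : |s j - s' j| ≤ 1 / r := by
  have h2 := Int.abs_sub_lt_one_of_floor_eq_floor (congrFun h j : ⌊r * s j⌋ = ⌊r * s' j⌋)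
  rw [← mul_sub, abs_mul, abs_of_pos hr] at h2
  rw [le_div_iff₀ hr, mul_comm]
  exact h2.le

/-- The induction on scales: `m` steps from scale `1` to scale `q ^ m`. -/
theorem multilinear_chain {k d : ℕ} (hk : 2 ≤ k) (i₁ : Fin k) {X : Type} [MeasurableSpace X]
    {ν : Fin k → Measure X} {s : Fin k → X → Fin k ⊕ Fin d → ℝ} (hs : ∀ i, Measurable (s i))
    {B : ℝ} (hB : ∀ i ξ j, |s i ξ j| ≤ B) {q μ a : ℝ} (hq : 1 ≤ q) (hμ : 0 < μ) (ha : 2 ≤ a)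
    (hown : ∀ i ξ η r, (∀ j, |s i ξ j - s i η j| ≤ r) →
      q * |s i ξ (Sum.inl i) - s i η (Sum.inl i)| ≤ a * r)
    (hsmall : ∀ ξ η l, |s i₁ ξ (Sum.inr l) - s i₁ η (Sum.inr l)| ≤ 2 * μ)
    {ι : Type} [Countable ι] {f : Fin k → ι → X → ℂ} (hf : ∀ i j, Integrable (f i j) (ν i))
    (m : ℕ) :
    ∃ (ι' : Type) (_ : Countable ι') (f' : Fin k → ι' → X → ℂ),
      (∀ i j, Integrable (f' i j) (ν i)) ∧
      (∀ i, sqNorm (ν i) (f' i) ≤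
        (monomConst (Fin k ⊕ Fin d) 1 * monomConst (Fin k ⊕ Fin d) a) ^ m * sqNorm (ν i) (f i)) ∧
      ∀ b : ℝ, ∫⁻ c in box (Fin k ⊕ Fin d) b,
          ∏ i, squareFn (ν i) (s i) 1 (f i) c ^ (1 / ((k : ℝ) - 1)) ≤
        ENNReal.ofReal (stepConst k d ^ m * (max 1 (q ^ m * μ)) ^ ((d : ℝ) / (k - 1))) *
          ∫⁻ c in box (Fin k ⊕ Fin d) (b + m * q ^ m),
            ∏ i, squareFn (ν i) (s i) (q ^ m) (f' i) c ^ (1 / ((k : ℝ) - 1)) := by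
  have hk1 : (0 : ℝ) < (k : ℝ) - 1 := by
    have : (2 : ℝ) ≤ k := by exact_mod_cast hk
    linarith
  have hpi := Real.pi_pos
  have hst : 0 ≤ stepConst k d := by unfold stepConst; positivity
  induction m with
  | zero =>
    refine ⟨ι, inferInstance, f, hf, fun i => by simp, fun b => ?_⟩
    have h1 : (1 : ℝ) ≤ max 1 (q ^ 0 * μ) ^ ((d : ℝ) / (k - 1)) :=
      Real.one_le_rpow (le_max_left _ _) (by positivity)
    simp only [pow_zero, Nat.cast_zero, zero_mul, add_zero, one_mul] at *
    exact le_mul_of_one_le_left' (by rwa [ENNReal.one_le_ofReal])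
  | succ m ih =>
    obtain ⟨ι₁, _, f₁, hf₁, hn₁, hI₁⟩ := ih
    set r := q ^ m with hrdef
    have hr : 0 < r := by positivity
    have hρ : q ^ (m + 1) = q * r := by rw [pow_succ, mul_comm]
    rw [hρ]
    set ρ := q * r with hρdef
    have hρ0 : 0 < ρ := by positivity
    have hrρ : r ≤ ρ := le_mul_of_one_le_left hr.le hq
    have hσr : 0 < max 1 (r * μ) := lt_max_of_lt_left one_pos
    have hσρ : 0 < max 1 (ρ * μ) := lt_max_of_lt_left one_pos
    have hσ : max 1 (r * μ) ≤ max 1 (ρ * μ) := max_le_max le_rfl (by gcongr)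
    -- This choice makes the losses telescope. It equals ρ if ρμ ≤ 1, r if rμ ≥ 1, and 1/μ in the
    -- transition between them. In the first and last cases the last coordinates vary by at most 2μ
    -- ≤ 2/ℓ; if rμ ≥ 1, the cell alone gives 1/r = 1/ℓ.
    set ℓ := ρ * (max 1 (r * μ) / max 1 (ρ * μ)) with hℓdef
    have hℓ : 0 < ℓ := by positivity
    have hℓρ : ℓ ≤ ρ := mul_le_of_le_one_right hρ0.le ((div_le_one hσρ).2 hσ)
    obtain ⟨ι₂, hc₂, f₂, hf₂, hn₂, hI₂⟩ := multilinear_step hk i₁ hs hB (r := r) (ρ := ρ) (ℓ := ℓ)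
      (a := a) hr hrρ hℓ hℓρ (by linarith)
      (fun i ξ η h => by
        have h1 := hown i ξ η (1 / r) fun j => abs_sub_le_of_cell_eq hr h j
        rw [hρdef, mul_comm q r, mul_assoc]
        calc _ ≤ r * (a * (1 / r)) := by gcongr
          _ = a := by field_simp)
      (fun ξ η h l => by
        have h1 := abs_sub_le_of_cell_eq hr h (Sum.inr l)
        have h2 := hsmall ξ η l
        set t := |s i₁ ξ (Sum.inr l) - s i₁ η (Sum.inr l)| with ht
        have ht0 : 0 ≤ t := abs_nonneg _
        rcases le_total (ρ * μ) 1 with h3 | h3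
        · calc ℓ * t ≤ ρ * (2 * μ) := by gcongr
            _ ≤ a := by linarith
        · have h4 : ℓ = max 1 (r * μ) / μ := by
            rw [hℓdef, max_eq_right h3]
            field_simp
          rw [h4]
          rcases le_total (r * μ) 1 with h5 | h5
          · rw [max_eq_left h5]
            calc 1 / μ * t ≤ 1 / μ * (2 * μ) := by gcongr
              _ = 2 := by field_simp
              _ ≤ a := ha
          · rw [max_eq_right h5]
            calc r * μ / μ * t ≤ r * μ / μ * (1 / r) := by gcongr
              _ = 1 := by field_simp
              _ ≤ a := by linarith) hf₁
    refine ⟨ι₂, hc₂, f₂, hf₂, fun i => ?_, fun b => ?_⟩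
    · refine (hn₂ i).trans ?_
      rw [pow_succ', mul_assoc _ _ (sqNorm _ (f i))]
      gcongr
      exact hn₁ i
    · refine (hI₁ b).trans ?_
      calc _ ≤ ENNReal.ofReal (stepConst k d ^ m * max 1 (r * μ) ^ ((d : ℝ) / (k - 1))) *
            (ENNReal.ofReal (stepConst k d * (ρ / ℓ) ^ ((d : ℝ) / (k - 1))) *
              ∫⁻ c in box (Fin k ⊕ Fin d) (b + m * r + ρ),
                ∏ i, squareFn (ν i) (s i) ρ (f₂ i) c ^ (1 / ((k : ℝ) - 1))) := by
            gcongr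
            exact hI₂ _
        _ = ENNReal.ofReal (stepConst k d ^ (m + 1) * max 1 (ρ * μ) ^ ((d : ℝ) / (k - 1))) *
              ∫⁻ c in box (Fin k ⊕ Fin d) (b + m * r + ρ),
                ∏ i, squareFn (ν i) (s i) ρ (f₂ i) c ^ (1 / ((k : ℝ) - 1)) := by
            rw [← mul_assoc, ← ENNReal.ofReal_mul (by positivity)]
            congr 2
            have h5 : max 1 (ρ * μ) = max 1 (r * μ) * (ρ / ℓ) := by
              rw [hℓdef]
              field_simp
            rw [h5, Real.mul_rpow hσr.le (by positivity)]
            ring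
        _ ≤ _ := by
            gcongr
            refine box_mono _ ?_
            push_cast
            nlinarith [mul_le_mul_of_nonneg_left hrρ (Nat.cast_nonneg (α := ℝ) m)]

/-- The multilinear estimate in linear coordinates adapted to the surfaces. -/
theorem lintegral_prod_expo_le {k d : ℕ} (hk : 2 ≤ k) (i₁ : Fin k) {X : Type} [MeasurableSpace X]
    {ν : Fin k → Measure X} {s : Fin k → X → Fin k ⊕ Fin d → ℝ} (hs : ∀ i, Measurable (s i))
    {B : ℝ} (hB : ∀ i ξ j, |s i ξ j| ≤ B) {q μ a : ℝ} (hq : 1 ≤ q) (hμ : 0 < μ) (ha : 2 ≤ a)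
    (hown : ∀ i ξ η r, (∀ j, |s i ξ j - s i η j| ≤ r) →
      q * |s i ξ (Sum.inl i) - s i η (Sum.inl i)| ≤ a * r)
    (hsmall : ∀ ξ η l, |s i₁ ξ (Sum.inr l) - s i₁ η (Sum.inr l)| ≤ 2 * μ)
    {f : Fin k → X → ℂ} (hf : ∀ i, Integrable (f i) (ν i)) (m : ℕ) {v : Fin k → ℝ≥0∞}
    (hv : ∀ i θ, ν i (cellSet (s i) (q ^ m) θ) ≤ v i) :
    ∫⁻ τ in box (Fin k ⊕ Fin d) (q ^ m),
        ∏ i, (‖∫ ξ, expo τ (s i ξ) * f i ξ ∂ν i‖ₑ ^ 2) ^ (1 / ((k : ℝ) - 1)) ≤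
      (((Fintype.piFinset fun _ : Fin k ⊕ Fin d => Finset.Icc ⌊-(1 * B)⌋ ⌊1 * B⌋).card *
        (monomConst (Fin k ⊕ Fin d) 1 * monomConst (Fin k ⊕ Fin d) a) ^ m) ^ ((k : ℝ) / (k - 1)) *
        ENNReal.ofReal (stepConst k d ^ m * (2 * (m + 1)) ^ (k + d))) *
      ENNReal.ofReal (max 1 (q ^ m * μ) ^ ((d : ℝ) / (k - 1)) * (q ^ m) ^ (k + d)) *
        ∏ i, (v i * ∫⁻ ξ, ‖f i ξ‖ₑ ^ 2 ∂ν i) ^ (1 / ((k : ℝ) - 1)) := by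
  have hk1 : (0 : ℝ) < (k : ℝ) - 1 := by
    have : (2 : ℝ) ≤ k := by exact_mod_cast hk
    linarith
  have hp : 0 ≤ 1 / ((k : ℝ) - 1) := by positivity
  have hpi := Real.pi_pos
  have hst : 0 ≤ stepConst k d := by unfold stepConst; positivity
  obtain ⟨ι', _, f', hf', hn', hI'⟩ := multilinear_chain hk i₁ hs hB hq hμ ha hown hsmall
    (f := fun i (_ : Unit) => f i) (fun i _ => hf i) m
  set N : ℝ≥0∞ :=
    (((Fintype.piFinset fun _ : Fin k ⊕ Fin d => Finset.Icc ⌊-(1 * B)⌋ ⌊1 * B⌋).card : ℕ) : ℝ≥0∞)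
    with hN
  set K := (monomConst (Fin k ⊕ Fin d) 1 * monomConst (Fin k ⊕ Fin d) a) ^ m with hK
  set p := 1 / ((k : ℝ) - 1) with hpdef
  have hpow : ∀ x : ℝ≥0∞, ∏ _i : Fin k, x ^ p = x ^ ((k : ℝ) / (k - 1)) := fun x => by
    rw [Finset.prod_const, Finset.card_univ, Fintype.card_fin, ← ENNReal.rpow_natCast,
      ← ENNReal.rpow_mul, hpdef]
    congr 1
    ring
  have hNp : N ^ ((k : ℝ) / (k - 1)) ≠ ⊤ :=
    ENNReal.rpow_ne_top_of_nonneg (by positivity) (ENNReal.natCast_ne_top _)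
  have hnorm : ∀ i, sqNorm (ν i) (f' i) ≤ K * ∫⁻ ξ, ‖f i ξ‖ₑ ^ 2 ∂ν i := fun i => by
    refine (hn' i).trans_eq ?_
    simp [sqNorm]
  -- Pass to the square functions at scale one, run the chain, and bound the integrand at scale q^m
  -- by a constant. Only the volume of the enlarged box, of side 2(m + 1)q^m, then remains.
  calc _ ≤ ∫⁻ τ in box (Fin k ⊕ Fin d) (q ^ m), N ^ ((k : ℝ) / (k - 1)) *
          ∏ i, squareFn (ν i) (s i) 1 (fun _ : Unit => f i) τ ^ p := by
        refine lintegral_mono fun τ => ?_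
        rw [← hpow, ← Finset.prod_mul_distrib]
        refine Finset.prod_le_prod' fun i _ => ?_
        rw [← ENNReal.mul_rpow_of_nonneg _ _ hp]
        exact ENNReal.rpow_le_rpow
          (enorm_integral_expo_sq_le_squareFn (hB i) one_pos (hs i) (hf i) τ) hp
    _ = N ^ ((k : ℝ) / (k - 1)) * ∫⁻ τ in box (Fin k ⊕ Fin d) (q ^ m),
          ∏ i, squareFn (ν i) (s i) 1 (fun _ : Unit => f i) τ ^ p :=
        lintegral_const_mul' _ _ hNp
    _ ≤ N ^ ((k : ℝ) / (k - 1)) *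
          (ENNReal.ofReal (stepConst k d ^ m * (max 1 (q ^ m * μ)) ^ ((d : ℝ) / (k - 1))) *
          ∫⁻ c in box (Fin k ⊕ Fin d) (q ^ m + m * q ^ m),
            ∏ i, squareFn (ν i) (s i) (q ^ m) (f' i) c ^ p) := by
        gcongr
        exact hI' _
    _ ≤ N ^ ((k : ℝ) / (k - 1)) *
          (ENNReal.ofReal (stepConst k d ^ m * (max 1 (q ^ m * μ)) ^ ((d : ℝ) / (k - 1))) *
          ∫⁻ _ in box (Fin k ⊕ Fin d) (q ^ m + m * q ^ m),
            ∏ i, (K * (v i * ∫⁻ ξ, ‖f i ξ‖ₑ ^ 2 ∂ν i)) ^ p) := by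
        gcongr with c i
        refine (squareFn_le_mul_sqNorm (hs i) (hv i) (hf' i) c).trans ?_
        rw [mul_left_comm]
        gcongr
        exact hnorm i
    _ = _ := by
        rw [setLIntegral_const, volume_box, Fintype.card_sum, Fintype.card_fin, Fintype.card_fin]
        simp only [ENNReal.mul_rpow_of_nonneg _ _ hp, Finset.prod_mul_distrib, hpow]
        rw [ENNReal.mul_rpow_of_nonneg _ _ (by positivity : 0 ≤ (k : ℝ) / (k - 1)),
          ← ENNReal.ofReal_pow (by positivity),
          show 2 * (q ^ m + m * q ^ m) = (2 * (m + 1)) * q ^ m by ring, mul_pow,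
          ENNReal.ofReal_mul (by positivity), ENNReal.ofReal_mul (by positivity),
          ENNReal.ofReal_mul (by positivity), ENNReal.ofReal_mul (by positivity)]
        ring

/-! ### Geometry of regular parametrizations -/

/-- The second derivative bound makes DS Lipschitz with constant A on the convex set V; then the
mean value inequality applies to S - DS(ξ₀). Order two is all the regularity that the proof uses. -/
theorem IsRegularParam.norm_sub_sub_le {n : ℕ} {A κ ρ δ : ℝ} {V U : Set (Euc n)}
    {S : Euc n → Euc (n + 1)} (h : IsRegularParam 2 A κ ρ V U S) {ξ₀ ξ η : Euc n} (hξ₀ : ξ₀ ∈ V)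
    (hξ : ξ ∈ V) (hη : η ∈ V) (hξδ : ‖ξ - ξ₀‖ ≤ δ) (hηδ : ‖η - ξ₀‖ ≤ δ) :
    ‖S ξ - S η - fderiv ℝ S ξ₀ (ξ - η)‖ ≤ A * δ * ‖ξ - η‖ := by
  have hA : 0 ≤ A := (norm_nonneg _).trans (h.deriv_bound 0 (by norm_num) ξ₀ hξ₀)
  have hcd : ∀ x ∈ V, ContDiffAt ℝ ∞ S x := fun x hx =>
    h.smooth.contDiffAt (h.isOpen_big.mem_nhds hx)
  have hd : ∀ x ∈ V, DifferentiableAt ℝ S x := fun x hx => (hcd x hx).differentiableAt (by simp)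
  have hdd : ∀ x ∈ V, DifferentiableAt ℝ (fderiv ℝ S) x := fun x hx =>
    ((hcd x hx).fderiv_right (m := 1) (by
      rw [one_add_one_eq_two]; exact WithTop.coe_le_coe.2 (le_top : (2 : ℕ∞) ≤ ⊤))).differentiableAt (by simp)
  have hlip : ∀ x ∈ V, ‖fderiv ℝ S x - fderiv ℝ S ξ₀‖ ≤ A * ‖x - ξ₀‖ := fun x hx =>
    Convex.norm_image_sub_le_of_norm_fderiv_le (𝕜 := ℝ) hdd (fun y hy => by
      rw [← norm_iteratedFDeriv_one, norm_iteratedFDeriv_fderiv]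
      exact h.deriv_bound 2 le_rfl y hy) h.convex_big hξ₀ hx
  refine Convex.norm_image_sub_le_of_norm_fderiv_le' (𝕜 := ℝ) (s := V ∩ Metric.closedBall ξ₀ δ)
    (fun x hx => hd x hx.1) (fun x hx => (hlip x hx.1).trans ?_)
    (h.convex_big.inter (convex_closedBall _ _)) ⟨hη, ?_⟩ ⟨hξ, ?_⟩
  · have := hx.2
    rw [Metric.mem_closedBall, dist_eq_norm] at this
    gcongr
  · rwa [Metric.mem_closedBall, dist_eq_norm]
  · rwa [Metric.mem_closedBall, dist_eq_norm]

theorem exists_isUnitNormal {n : ℕ} (S : Euc n → Euc (n + 1)) (ξ : Euc n) :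
    ∃ N, IsUnitNormal S ξ N := by
  have hlt : Module.finrank ℝ (fderiv ℝ S ξ).range < Module.finrank ℝ (Euc (n + 1)) := by
    refine (LinearMap.finrank_range_le _).trans_lt ?_
    simp
  have hne : ((fderiv ℝ S ξ).range)ᗮ ≠ ⊥ := by
    rw [Ne, Submodule.orthogonal_eq_bot_iff]
    intro h
    rw [h, finrank_top] at hlt
    exact lt_irrefl _ hlt
  obtain ⟨x, hx, hx0⟩ := Submodule.exists_mem_ne_zero_of_ne_bot hne
  refine ⟨‖x‖⁻¹ • x, ?_, fun v => ?_⟩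
  · rw [norm_smul, norm_inv, norm_norm, inv_mul_cancel₀ (norm_ne_zero_iff.2 hx0)]
  · have h0 : inner ℝ (fderiv ℝ S ξ v) x = 0 :=
      (Submodule.mem_orthogonal _ _).1 hx _ (LinearMap.mem_range_self _ v)
    rw [inner_smul_right, h0, mul_zero]

/-- The constant in Cramer's rule for matrices with entries at most `1` and determinant at least
`ν`. -/
noncomputable def cramerConst (D : ℕ) (ν : ℝ) : ℝ := D * D.factorial / ν

/-- Multiply by the adjugate: its entries are determinants of matrices with entries at most 1, hence
at most D!. -/
theorem Matrix.abs_apply_le_of_abs_mulVec_le {D : ℕ} {M : Matrix (Fin D) (Fin D) ℝ}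
    (hM : ∀ i j, |M i j| ≤ 1) {ν : ℝ} (hν : 0 < ν) (hdet : ν ≤ |M.det|) {x : Fin D → ℝ} {t : ℝ}
    (ht : ∀ i, |M.mulVec x i| ≤ t) (j : Fin D) : |x j| ≤ cramerConst D ν * t := by
  have ht0 : 0 ≤ t := (abs_nonneg _).trans (ht j)
  have hadj : ∀ i j, |M.adjugate i j| ≤ D.factorial := by
    intro i j
    rw [Matrix.adjugate_apply]
    have := Matrix.det_le (A := M.updateRow j (Pi.single i 1)) (abv := AbsoluteValue.abs) (x := 1)
      (fun a b => ?_)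
    · simpa using this
    · by_cases hb : a = j
      · subst hb
        rw [Matrix.updateRow_self]
        by_cases hi : b = i
        · subst hi; simp
        · simp [hi]
      · rw [Matrix.updateRow_ne hb]
        exact hM a b
  have h1 : M.det * x j = (M.adjugate.mulVec (M.mulVec x)) j := by
    rw [Matrix.mulVec_mulVec, Matrix.adjugate_mul, Matrix.smul_mulVec, Matrix.one_mulVec,
      Pi.smul_apply, smul_eq_mul]
  have h2 : |M.det| * |x j| ≤ D * D.factorial * t := by
    rw [← abs_mul, h1]
    calc |(M.adjugate.mulVec (M.mulVec x)) j|
        ≤ ∑ i, |M.adjugate j i * M.mulVec x i| :=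
          Finset.abs_sum_le_sum_abs (fun i => M.adjugate j i * M.mulVec x i) Finset.univ
      _ ≤ ∑ _i : Fin D, D.factorial * t := by
          refine Finset.sum_le_sum fun i _ => ?_
          rw [abs_mul]
          exact mul_le_mul (hadj j i) (ht i) (abs_nonneg _) (by positivity)
      _ = D * D.factorial * t := by simp; ring
  rw [cramerConst, div_mul_eq_mul_div, le_div_iff₀ hν]
  calc |x j| * ν ≤ |x j| * |M.det| := by gcongr
    _ ≤ _ := by rw [mul_comm]; exact h2

theorem abs_apply_le_one {D : ℕ} {x : Euc D} (hx : ‖x‖ = 1) (i : Fin D) : |x i| ≤ 1 := by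
  have := PiLp.norm_apply_le x i
  rwa [hx, Real.norm_eq_abs] at this

theorem norm_le_of_abs_le {D : ℕ} {x : Euc D} {t : ℝ} (h : ∀ i, |x i| ≤ t) : ‖x‖ ≤ D * t := by
  rcases D.eq_zero_or_pos with rfl | hD
  · simp [EuclideanSpace.norm_eq]
  have ht : 0 ≤ t := (abs_nonneg _).trans (h ⟨0, hD⟩)
  rw [EuclideanSpace.norm_eq, Real.sqrt_le_left (by positivity)]
  calc ∑ i, ‖x i‖ ^ 2 ≤ ∑ _i : Fin D, t ^ 2 := by
        refine Finset.sum_le_sum fun i _ => ?_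
        gcongr
        exact h i
    _ = D * t ^ 2 := by simp
    _ ≤ (D * t) ^ 2 := by
        rw [mul_pow]
        gcongr
        have : (1 : ℝ) ≤ D := by exact_mod_cast hD
        nlinarith

theorem norm_le_of_abs_inner_le {D : ℕ} {N : Fin D → Euc D} (hN : ∀ i, ‖N i‖ = 1) {ν : ℝ}
    (hν : 0 < ν) (hdet : ν ≤ |(Matrix.of fun i j => N i j).det|) {x : Euc D} {t : ℝ}
    (ht : ∀ i, |inner ℝ (N i) x| ≤ t) : ‖x‖ ≤ D * cramerConst D ν * t := by
  rw [mul_assoc]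
  refine norm_le_of_abs_le fun j => ?_
  refine Matrix.abs_apply_le_of_abs_mulVec_le (M := Matrix.of fun i j => N i j)
    (fun i j => abs_apply_le_one (hN i) j) hν hdet (x := x) (fun i => ?_) j
  refine le_of_eq_of_le ?_ (ht i)
  congr 1
  rw [EuclideanSpace.inner_eq_star_dotProduct]
  simp [Matrix.mulVec, dotProduct_comm]

/-- Change variables to coordinates in the basis N. The Jacobian is at most D! because the vectors
are unit, and Cramer's rule puts the ball inside the box. -/
theorem lintegral_ball_le_lintegral_box {D : ℕ} {J : Type} [Fintype J] (e : J ≃ Fin D)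
    {N : Fin D → Euc D} (hN : ∀ i, ‖N i‖ = 1) {ν : ℝ}
    (hν : 0 < ν) (hdet : ν ≤ |(Matrix.of fun i j => N i j).det|) {F : Euc D → ℝ≥0∞}
    (hF : Measurable F) (R : ℝ) :
    ∫⁻ x in Metric.ball 0 R, F x ≤ D.factorial *
      ∫⁻ τ in box J (cramerConst D ν * R), F (∑ j, τ j • N (e j)) := by
  set P : Matrix (Fin D) (Fin D) ℝ := (Matrix.of fun i j => N i j).transpose with hP
  have hPe : ∀ i j, |P i j| ≤ 1 := fun i j => abs_apply_le_one (hN j) i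
  have hPdet : ν ≤ |P.det| := by rwa [hP, Matrix.det_transpose]
  have hPdet0 : P.det ≠ 0 := fun h => by rw [h, abs_zero] at hPdet; linarith
  have hPle : |P.det| ≤ D.factorial := by
    have := Matrix.det_le (A := P) (abv := AbsoluteValue.abs) (x := 1) hPe
    simpa using this
  have h1 := (EuclideanSpace.volume_preserving_symm_measurableEquiv_toLp (Fin D)).symm
  have h2 : (volume : Measure (Fin D → ℝ)) =
      ENNReal.ofReal |P.det| • Measure.map (Matrix.toLin' P) volume := by
    rw [Real.map_matrix_volume_pi_eq_smul_volume_pi hPdet0, smul_smul, ← ENNReal.ofReal_mul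
      (abs_nonneg _), ← abs_mul, mul_inv_cancel₀ hPdet0, abs_one, ENNReal.ofReal_one, one_smul]
  have h3 := volume_measurePreserving_piCongrLeft (fun _ : Fin D => ℝ) e
  have hFi : Measurable ((Metric.ball (0 : Euc D) R).indicator F) :=
    hF.indicator measurableSet_ball
  have htoLp : Measurable (fun y : Fin D → ℝ => (WithLp.toLp 2 y : Euc D)) :=
    (MeasurableEquiv.toLp 2 (Fin D → ℝ)).measurable
  have hlin : Measurable (Matrix.toLin' P) := (LinearMap.continuous_of_finiteDimensional _).measurable
  rw [← lintegral_indicator measurableSet_ball, ← h1.lintegral_comp hFi]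
  have h4 : ∀ y : Fin D → ℝ, (MeasurableEquiv.toLp 2 (Fin D → ℝ)).symm.symm y =
    (WithLp.toLp 2 y : Euc D) := fun y => rfl
  simp only [h4]
  have hFt : Measurable fun y : Fin D → ℝ =>
      (Metric.ball (0 : Euc D) R).indicator F (WithLp.toLp 2 y) := hFi.comp htoLp
  have hFl : Measurable fun y : Fin D → ℝ =>
      (Metric.ball (0 : Euc D) R).indicator F (WithLp.toLp 2 (Matrix.toLin' P y)) := hFt.comp hlin
  rw [h2, lintegral_smul_measure, lintegral_map hFt hlin, ← h3.lintegral_comp hFl, smul_eq_mul, ← lintegral_indicator (measurableSet_box _ _)]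
  gcongr with τ
  · rw [← ENNReal.ofReal_natCast]
    exact ENNReal.ofReal_le_ofReal hPle
  · have h5 : (WithLp.toLp 2 (Matrix.toLin' P (MeasurableEquiv.piCongrLeft (fun _ : Fin D => ℝ) e τ))
        : Euc D) = ∑ j, τ j • N (e j) := by
      rw [← e.symm.sum_comp]
      ext a
      simp only [Matrix.toLin'_apply, Matrix.mulVec, dotProduct, WithLp.ofLp_sum, Finset.sum_apply,
        WithLp.ofLp_smul, Pi.smul_apply, smul_eq_mul, e.apply_symm_apply, hP,
        Matrix.transpose_apply, Matrix.of_apply]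
      refine Finset.sum_congr rfl fun i _ => ?_
      rw [mul_comm]
      congr 1
      have := MeasurableEquiv.piCongrLeft_apply_apply (β := fun _ : Fin D => ℝ) e τ (e.symm i)
      rwa [e.apply_symm_apply] at this
    simp only [h5]
    by_cases hx : ∑ j, τ j • N (e j) ∈ Metric.ball (0 : Euc D) R
    · rw [indicator_of_mem hx, indicator_of_mem]
      rw [mem_box]
      intro j
      have h6 := Matrix.abs_apply_le_of_abs_mulVec_le hPe hν hPdet
        (x := MeasurableEquiv.piCongrLeft (fun _ : Fin D => ℝ) e τ) (t := R) (fun i => ?_) (e j)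
      · rwa [MeasurableEquiv.piCongrLeft_apply_apply] at h6
      · have h7 : P.mulVec (MeasurableEquiv.piCongrLeft (fun _ : Fin D => ℝ) e τ) i =
            (∑ j, τ j • N (e j) : Euc D) i := by rw [← h5]; rfl
        rw [h7]
        exact (PiLp.norm_apply_le _ i).trans (mem_ball_zero_iff.1 hx).le
    · rw [indicator_of_notMem hx]
      exact zero_le

/-- A set on which `Φ` expands distances has volume controlled by that of a box containing its
image. -/
theorem volume_le_of_norm_sub_le {n : ℕ} {J : Type} [Fintype J] (hJ : Fintype.card J = n)
    {Φ : Euc n → J → ℝ} {P : Set (Euc n)} {c : ℝ≥0} {w : J → ℝ}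
    (hc : ∀ ξ ∈ P, ∀ η ∈ P, ‖ξ - η‖ ≤ c * ‖Φ ξ - Φ η‖)
    (hw : ∀ ξ ∈ P, ∀ η ∈ P, ∀ j, |Φ ξ j - Φ η j| ≤ w j) :
    volume P ≤ (c : ℝ≥0∞) ^ n * ∏ j, ENNReal.ofReal (2 * w j) := by
  rcases P.eq_empty_or_nonempty with rfl | ⟨ξ₀, hξ₀⟩
  · simp
  have hinj : InjOn Φ P := fun ξ hξ η hη h => by
    have := hc ξ hξ η hη
    rw [h, sub_self, norm_zero, mul_zero] at this
    exact sub_eq_zero.1 (norm_le_zero_iff.1 this)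
  -- The inverse of Φ is Lipschitz on the image with constant c, also for the sup norms, so
  -- n-dimensional Hausdorff measure grows by at most c^n. For sup norms that measure is Lebesgue
  -- measure.
  set Ψ : (J → ℝ) → (Fin n → ℝ) := fun y => (Function.invFunOn Φ P y).ofLp with hΨ
  have hΨΦ : ∀ ξ ∈ P, Ψ (Φ ξ) = ξ.ofLp := fun ξ hξ => by
    simp only [hΨ]
    rw [hinj.leftInvOn_invFunOn hξ]
  have hlip : LipschitzOnWith c Ψ (Φ '' P) := by
    refine LipschitzOnWith.of_dist_le_mul ?_
    rintro _ ⟨ξ, hξ, rfl⟩ _ ⟨η, hη, rfl⟩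
    rw [hΨΦ ξ hξ, hΨΦ η hη, dist_eq_norm, dist_eq_norm]
    refine le_trans ?_ (hc ξ hξ η hη)
    rw [pi_norm_le_iff_of_nonneg (norm_nonneg _)]
    exact fun i => PiLp.norm_apply_le (ξ - η) i
  have himg : Ψ '' (Φ '' P) = WithLp.ofLp '' P := by
    rw [image_image]
    exact image_congr hΨΦ
  have hvolP : volume P = volume (WithLp.ofLp '' P : Set (Fin n → ℝ)) := by
    have h1 := EuclideanSpace.volume_preserving_symm_measurableEquiv_toLp (Fin n)
    have h2 := h1.measure_preimage_equiv (WithLp.ofLp '' P)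
    rw [← h2]
    congr 1
    exact (preimage_image_eq P (WithLp.ofLp_injective 2)).symm
  have h1 := hlip.hausdorffMeasure_image_le (d := n) (by positivity)
  rw [himg] at h1
  have e1 : (μH[(n : ℝ)] : Measure (Fin n → ℝ)) = volume := by
    have := hausdorffMeasure_pi_real (ι := Fin n)
    rwa [Fintype.card_fin] at this
  have e2 : (μH[(n : ℝ)] : Measure (J → ℝ)) = volume := by
    have := hausdorffMeasure_pi_real (ι := J)
    rwa [hJ] at this
  rw [e1, e2, ENNReal.rpow_natCast] at h1
  rw [hvolP]
  refine h1.trans ?_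
  gcongr
  have hsub : Φ '' P ⊆ Set.pi univ fun j => Icc (Φ ξ₀ j - w j) (Φ ξ₀ j + w j) := by
    rintro _ ⟨ξ, hξ, rfl⟩ j _
    have := abs_le.1 (hw ξ hξ ξ₀ hξ₀ j)
    exact ⟨by linarith, by linarith⟩
  refine (measure_mono hsub).trans_eq ?_
  rw [volume_pi, Measure.pi_pi]
  refine Finset.prod_congr rfl fun j _ => ?_
  rw [Real.volume_Icc]
  ring_nf

/-! ### The estimate for small pieces of the surfaces -/

/-- The functional ⟨N, ·⟩ is constant on H, and each of the two points contributes at most μ. The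
room ε in the proof provides actual points of H nearby. -/
theorem abs_inner_sub_inner_le_of_mem_cthickening {D : ℕ} {H : AffineSubspace ℝ (Euc D)} {μ : ℝ}
    {N x y : Euc D} (hN : ‖N‖ = 1) (hNH : N ∈ H.directionᗮ)
    (hx : x ∈ Metric.cthickening μ (H : Set (Euc D)))
    (hy : y ∈ Metric.cthickening μ (H : Set (Euc D))) (hμ : 0 < μ) :
    |inner ℝ N x - inner ℝ N y| ≤ 2 * μ := by
  refine le_of_forall_pos_le_add fun ε hε => ?_
  have hsub := Metric.cthickening_subset_thickening' (δ₁ := μ) (δ₂ := μ + ε / 2)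
    (by positivity) (by linarith) (H : Set (Euc D))
  obtain ⟨x', hx', hxx'⟩ := Metric.mem_thickening_iff.1 (hsub hx)
  obtain ⟨y', hy', hyy'⟩ := Metric.mem_thickening_iff.1 (hsub hy)
  rw [dist_eq_norm] at hxx' hyy'
  have h0 : inner ℝ N (x' - y') = 0 := by
    rw [real_inner_comm]
    exact (Submodule.mem_orthogonal _ _).1 hNH _ (H.vsub_mem_direction hx' hy')
  have h1 : inner ℝ N x - inner ℝ N y = inner ℝ N (x - x') - inner ℝ N (y - y') := by
    rw [inner_sub_right] at h0
    rw [inner_sub_right, inner_sub_right]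
    linarith
  have h2 := abs_real_inner_le_norm N (x - x')
  have h3 := abs_real_inner_le_norm N (y - y')
  rw [hN, one_mul] at h2 h3
  rw [h1]
  refine (abs_sub _ _).trans ?_
  linarith

/-- Completing `k` vectors by an orthonormal basis of a subspace of dimension `d`. -/
theorem exists_completion {n k d : ℕ} (hd : k + d = n + 1) (hk : k ≤ n + 1)
    (W : Submodule ℝ (Euc (n + 1))) (hW : Module.finrank ℝ W = d) (N₁ : Fin k → Euc (n + 1)) :
    ∃ N : Fin (n + 1) → Euc (n + 1), (∀ i, N (Fin.castLE hk i) = N₁ i) ∧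
      Orthonormal ℝ (fun j : {j : Fin (n + 1) // k ≤ (j : ℕ)} => N j) ∧
      Submodule.span ℝ (Set.range fun j : {j : Fin (n + 1) // k ≤ (j : ℕ)} => N j) = W := by
  set b := (stdOrthonormalBasis ℝ W).reindex (finCongr hW) with hb
  have hlt : ∀ j : Fin (n + 1), ¬ (j : ℕ) < k → (j : ℕ) - k < d := fun j h => by omega
  set φ : {j : Fin (n + 1) // k ≤ (j : ℕ)} → Fin d := fun j =>
    ⟨(j : ℕ) - k, hlt j (not_lt.2 j.2)⟩ with hφ
  have hφi : Function.Injective φ := by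
    rintro ⟨i, hi⟩ ⟨j, hj⟩ h
    simp only [hφ, Fin.mk.injEq] at h
    rw [Subtype.mk.injEq, Fin.ext_iff]
    omega
  have hφs : Function.Surjective φ := fun l =>
    ⟨⟨⟨k + l, by omega⟩, by simp⟩, by simp [hφ]⟩
  have hbo : Orthonormal ℝ fun l => ((b l : W) : Euc (n + 1)) :=
    b.orthonormal.comp_linearIsometry W.subtypeₗᵢ
  refine ⟨fun j => if h : (j : ℕ) < k then N₁ ⟨j, h⟩ else (b ⟨(j : ℕ) - k, hlt j h⟩ : W),
    fun i => by simp, ?_⟩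
  have hN : (fun j : {j : Fin (n + 1) // k ≤ (j : ℕ)} =>
      if h : ((j : Fin (n + 1)) : ℕ) < k then N₁ ⟨j, h⟩ else
        ((b ⟨((j : Fin (n + 1)) : ℕ) - k, hlt j h⟩ : W) : Euc (n + 1))) =
      (fun l => ((b l : W) : Euc (n + 1))) ∘ φ := by
    funext j
    simp only [Function.comp_apply, hφ, dif_neg (not_lt.2 j.2)]
  rw [hN]
  refine ⟨hbo.comp φ hφi, ?_⟩
  rw [hφs.range_comp]
  have h1 : (Set.range fun l => ((b l : W) : Euc (n + 1))) = W.subtype '' Set.range b := by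
    rw [← range_comp]
    rfl
  rw [h1, Submodule.span_image, ← b.coe_toBasis, b.toBasis.span_eq, Submodule.map_top,
    Submodule.range_subtype]

/-- The factor by which the adapted linear coordinates of a surface control the parameters. -/
noncomputable def coordConst (n : ℕ) (κ ν : ℝ) : ℝ :=
  2 / κ * ((n + 1 : ℕ) * cramerConst (n + 1) ν)

/-- The diameter of the pieces of the surfaces, relative to the ratio of consecutive scales. -/
noncomputable def pieceSize (n : ℕ) (A κ ν : ℝ) : ℝ :=
  min (κ / (2 * A)) (1 / (2 * (A * coordConst n κ ν)))

/-- Here the power of μ appears. The powers of Q cancel, and the loss max(1, Qμ) of the chain is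
compensated by the thinness min(1/Q, 2μ) of the cells of the first surface: their product is at most
2μ on either side of Qμ = 1. -/
theorem prod_piece_volume_le {k d n : ℕ} (hk : 2 ≤ k) (i₁ : Fin k) {c Q μ : ℝ} (hc : 0 < c)
    (hQ : 0 < Q) (hμ : 0 < μ) :
    (max 1 (Q * μ) ^ ((d : ℝ) / (k - 1)) * Q ^ (k + d)) *
      ∏ i : Fin k, (c ^ n * ((2 / Q) ^ (k - 1) * if i = i₁ then (2 * min (1 / Q) (2 * μ)) ^ d
        else (2 / Q) ^ d)) ^ (1 / ((k : ℝ) - 1)) ≤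
      ((c ^ n) ^ k) ^ (1 / ((k : ℝ) - 1)) * 2 ^ (k + d) * 4 ^ ((d : ℝ) / (k - 1)) *
        μ ^ ((d : ℝ) / (k - 1)) := by
  have hk1 : (0 : ℝ) < (k : ℝ) - 1 := by
    have : (2 : ℝ) ≤ k := by exact_mod_cast hk
    linarith
  have hm0 : 0 < min (1 / Q) (2 * μ) := lt_min (by positivity) (by positivity)
  have hM0 : 0 < max 1 (Q * μ) := lt_max_of_lt_left one_pos
  have hnn : ∀ i : Fin k, 0 ≤ c ^ n * ((2 / Q) ^ (k - 1) *
      if i = i₁ then (2 * min (1 / Q) (2 * μ)) ^ d else (2 / Q) ^ d) := fun i => by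
    split_ifs <;> positivity
  rw [Real.finsetProd_rpow _ _ fun i _ => hnn i]
  set T := 2 * min (1 / Q) (2 * μ) with hT
  have hT0 : 0 < T := by positivity
  have h1 : ∏ i : Fin k, (c ^ n * ((2 / Q) ^ (k - 1) * if i = i₁ then T ^ d else (2 / Q) ^ d)) =
      (c ^ n) ^ k * ((2 / Q) ^ (k + d)) ^ (k - 1) * T ^ d := by
    rw [← Finset.mul_prod_erase _ _ (Finset.mem_univ i₁), if_pos rfl]
    have h2 : ∀ i ∈ Finset.univ.erase i₁, (c ^ n * ((2 / Q) ^ (k - 1) *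
        if i = i₁ then T ^ d else (2 / Q) ^ d)) = c ^ n * ((2 / Q) ^ (k - 1) * (2 / Q) ^ d) :=
      fun i hi => by rw [if_neg (Finset.ne_of_mem_erase hi)]
    rw [Finset.prod_congr rfl h2, Finset.prod_const, Finset.card_erase_of_mem (Finset.mem_univ _),
      Finset.card_univ, Fintype.card_fin]
    obtain ⟨m, rfl⟩ : ∃ m, k = m + 1 := ⟨k - 1, by omega⟩
    simp only [Nat.add_sub_cancel]
    have h3 : (2 / Q) ^ (m + 1 + d) = (2 / Q) * ((2 / Q) ^ m * (2 / Q) ^ d) := by ring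
    rw [h3, mul_pow (2 / Q), mul_pow (c ^ n)]
    ring
  rw [h1, Real.mul_rpow (by positivity) (by positivity), Real.mul_rpow (by positivity)
    (by positivity), ← Real.rpow_natCast ((2 / Q) ^ (k + d)), ← Real.rpow_mul (by positivity),
    Nat.cast_sub (by omega), Nat.cast_one, mul_one_div_cancel hk1.ne', Real.rpow_one,
    ← Real.rpow_natCast T, ← Real.rpow_mul hT0.le, mul_one_div]
  have h4 : max 1 (Q * μ) * T ≤ 4 * μ := by
    rcases le_total (Q * μ) 1 with h | h
    · rw [max_eq_left h, one_mul, hT]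
      linarith [min_le_right (1 / Q) (2 * μ)]
    · rw [max_eq_right h, hT]
      calc Q * μ * (2 * min (1 / Q) (2 * μ)) ≤ Q * μ * (2 * (1 / Q)) := by
            gcongr
            exact min_le_left _ _
        _ = 2 * μ := by field_simp
        _ ≤ 4 * μ := by linarith
  calc _ = ((c ^ n) ^ k) ^ (1 / ((k : ℝ) - 1)) * (Q ^ (k + d) * (2 / Q) ^ (k + d)) *
        (max 1 (Q * μ) ^ ((d : ℝ) / (k - 1)) * T ^ ((d : ℝ) / (k - 1))) := by ring
    _ = ((c ^ n) ^ k) ^ (1 / ((k : ℝ) - 1)) * 2 ^ (k + d) *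
        (max 1 (Q * μ) * T) ^ ((d : ℝ) / (k - 1)) := by
        rw [← mul_pow, mul_div_cancel₀ _ hQ.ne', Real.mul_rpow hM0.le hT0.le]
    _ ≤ ((c ^ n) ^ k) ^ (1 / ((k : ℝ) - 1)) * 2 ^ (k + d) * (4 * μ) ^ ((d : ℝ) / (k - 1)) := by
        gcongr
    _ = _ := by
        rw [Real.mul_rpow (by norm_num) hμ.le]
        ring

/-- The volume of the part of a piece of a surface lying in a lattice cell. -/
theorem volume_inter_cellSet_le {n k d : ℕ} (hd : k + d = n + 1) (i i₁ : Fin k) {P : Set (Euc n)}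
    {s₀ s : Euc n → Fin k ⊕ Fin d → ℝ} (hs : ∀ ξ ∈ P, s ξ = s₀ ξ) {c Q μ : ℝ} (hc : 0 < c)
    (hQ : 0 < Q)
    (hL : ∀ ξ ∈ P, ∀ η ∈ P, ∀ t, (∀ j, |s₀ ξ j - s₀ η j| ≤ t) → ‖ξ - η‖ ≤ c * t)
    (hO : ∀ ξ ∈ P, ∀ η ∈ P, c * |s₀ ξ (Sum.inl i) - s₀ η (Sum.inl i)| ≤ 1 / 2 * ‖ξ - η‖)
    (hsmall : i = i₁ → ∀ ξ ∈ P, ∀ η ∈ P, ∀ l, |s₀ ξ (Sum.inr l) - s₀ η (Sum.inr l)| ≤ 2 * μ)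
    (hμ : 0 < μ) (θ : Fin k ⊕ Fin d → ℤ) :
    volume (cellSet s Q θ ∩ P) ≤ ENNReal.ofReal (c ^ n * ((2 / Q) ^ (k - 1) *
      if i = i₁ then (2 * min (1 / Q) (2 * μ)) ^ d else (2 / Q) ^ d)) := by
  have hcell : ∀ ξ ∈ cellSet s Q θ ∩ P, ∀ η ∈ cellSet s Q θ ∩ P, ∀ j,
      |s₀ ξ j - s₀ η j| ≤ 1 / Q := by
    intro ξ hξ η hη j
    rw [← hs ξ hξ.2, ← hs η hη.2]
    have h1 : cell Q (s ξ) = θ := hξ.1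
    have h2 : cell Q (s η) = θ := hη.1
    exact abs_sub_le_of_cell_eq hQ (h1.trans h2.symm) j
  have hcard : Fintype.card {j : Fin k // j ≠ i} = k - 1 := by simp
  -- Dropping the surface's own coordinate leaves (k - 1) + d = n coordinates, the dimension of the
  -- parameter space.
  have h := volume_le_of_norm_sub_le (n := n) (J := {j : Fin k // j ≠ i} ⊕ Fin d)
    (by rw [Fintype.card_sum, hcard, Fintype.card_fin]; have := i.pos; omega)
    (Φ := fun ξ => Sum.elim (fun j => s₀ ξ (Sum.inl j)) (fun l => s₀ ξ (Sum.inr l)))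
    (P := cellSet s Q θ ∩ P) (c := c.toNNReal)
    (w := Sum.elim (fun _ => 1 / Q) (fun _ => if i = i₁ then min (1 / Q) (2 * μ) else 1 / Q))
    (fun ξ hξ η hη => ?_) (fun ξ hξ η hη => ?_)
  · refine h.trans_eq ?_
    rw [Fintype.prod_sum_type]
    simp only [Sum.elim_inl, Sum.elim_inr, Finset.prod_const, Finset.card_univ, hcard,
      Fintype.card_fin]
    have h2 : 0 < 2 * if i = i₁ then min (1 / Q) (2 * μ) else 1 / Q := by
      have := lt_min (a := (0 : ℝ)) (b := 1 / Q) (c := 2 * μ) (by positivity) (by positivity)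
      split_ifs <;> positivity
    have hcn : (c.toNNReal : ℝ≥0∞) = ENNReal.ofReal c := rfl
    rw [hcn, ← ENNReal.ofReal_pow hc.le, ← ENNReal.ofReal_pow (by positivity),
      ← ENNReal.ofReal_pow h2.le, ← ENNReal.ofReal_mul (by positivity),
      ← ENNReal.ofReal_mul (by positivity)]
    congr 3
    · ring
    · split_ifs <;> ring
  · set t := ‖(Sum.elim (fun j : {j : Fin k // j ≠ i} => s₀ ξ (Sum.inl j))
      (fun l => s₀ ξ (Sum.inr l)) : {j : Fin k // j ≠ i} ⊕ Fin d → ℝ) -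
      Sum.elim (fun j : {j : Fin k // j ≠ i} => s₀ η (Sum.inl j)) (fun l => s₀ η (Sum.inr l))‖
      with ht
    have ht1 : ∀ j, j ≠ Sum.inl i → |s₀ ξ j - s₀ η j| ≤ t := by
      rintro (j | l) hj
      · exact norm_le_pi_norm ((Sum.elim (fun j : {j : Fin k // j ≠ i} => s₀ ξ (Sum.inl j))
          (fun l => s₀ ξ (Sum.inr l)) : {j : Fin k // j ≠ i} ⊕ Fin d → ℝ) -
          Sum.elim (fun j : {j : Fin k // j ≠ i} => s₀ η (Sum.inl j)) (fun l => s₀ η (Sum.inr l)))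
          (Sum.inl ⟨j, fun h => hj (by rw [h])⟩)
      · exact norm_le_pi_norm ((Sum.elim (fun j : {j : Fin k // j ≠ i} => s₀ ξ (Sum.inl j))
          (fun l => s₀ ξ (Sum.inr l)) : {j : Fin k // j ≠ i} ⊕ Fin d → ℝ) -
          Sum.elim (fun j : {j : Fin k // j ≠ i} => s₀ η (Sum.inl j)) (fun l => s₀ η (Sum.inr l)))
          (Sum.inr l)
    rw [Real.coe_toNNReal c hc.le]
    -- If the own coordinate had the largest increment, `hL` and `hO` would give ‖ξ - η‖ ≤ ½‖ξ - η‖,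
    -- forcing ξ = η. The other coordinates therefore suffice.
    by_cases hown : |s₀ ξ (Sum.inl i) - s₀ η (Sum.inl i)| ≤ t
    · refine hL ξ hξ.2 η hη.2 t fun j => ?_
      by_cases hj : j = Sum.inl i
      · rw [hj]; exact hown
      · exact ht1 j hj
    · have h1 := hL ξ hξ.2 η hη.2 _ fun j => show |s₀ ξ j - s₀ η j| ≤
          |s₀ ξ (Sum.inl i) - s₀ η (Sum.inl i)| from by
        by_cases hj : j = Sum.inl i
        · rw [hj]
        · exact (ht1 j hj).trans (not_le.1 hown).le
      have h2 := hO ξ hξ.2 η hη.2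
      have h3 : 0 ≤ c * t := by positivity
      have h4 := norm_nonneg (ξ - η)
      linarith
  · rintro (j | l)
    · exact hcell ξ hξ η hη _
    · simp only [Sum.elim_inr]
      split_ifs with hi
      · exact le_min (hcell ξ hξ η hη _) (hsmall hi ξ hξ.2 η hη.2 l)
      · exact hcell ξ hξ η hη _

theorem cramerConst_pos {D : ℕ} (hD : 0 < D) {ν : ℝ} (hν : 0 < ν) : 0 < cramerConst D ν := by
  unfold cramerConst
  positivity

theorem coordConst_pos (n : ℕ) {κ ν : ℝ} (hκ : 0 < κ) (hν : 0 < ν) : 0 < coordConst n κ ν := by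
  have := cramerConst_pos (Nat.succ_pos n) hν
  unfold coordConst
  positivity

theorem pieceSize_pos (n : ℕ) {A κ ν : ℝ} (hA : 0 < A) (hκ : 0 < κ) (hν : 0 < ν) :
    0 < pieceSize n A κ ν := by
  have := coordConst_pos n hκ hν
  exact lt_min (by positivity) (by positivity)

section
variable {n : ℕ} {A κ ρ δ ν : ℝ} {V U P : Set (Euc n)} {S : Euc n → Euc (n + 1)} {ξ₀ ξ η : Euc n}

/-- Small pieces of a surface are almost flat: the normal coordinate varies slowly. -/
theorem IsRegularParam.abs_inner_normal_sub_le (h : IsRegularParam 2 A κ ρ V U S)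
    (hPU : P ⊆ U) (hP : ∀ ξ ∈ P, ∀ η ∈ P, ‖ξ - η‖ ≤ δ) (hξ₀ : ξ₀ ∈ P) {N : Euc (n + 1)}
    (hN : IsUnitNormal S ξ₀ N) (hξ : ξ ∈ P) (hη : η ∈ P) :
    |inner ℝ N (S ξ) - inner ℝ N (S η)| ≤ A * δ * ‖ξ - η‖ := by
  have h1 := h.norm_sub_sub_le (h.subset (hPU hξ₀)) (h.subset (hPU hξ)) (h.subset (hPU hη))
    (hP ξ hξ ξ₀ hξ₀) (hP η hη ξ₀ hξ₀)
  have h2 : inner ℝ N (S ξ) - inner ℝ N (S η) =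
      inner ℝ N (S ξ - S η - fderiv ℝ S ξ₀ (ξ - η)) := by
    have h0 : inner ℝ N (fderiv ℝ S ξ₀ (ξ - η)) = 0 := by rw [real_inner_comm]; exact hN.2 _
    rw [inner_sub_right, inner_sub_right, h0, sub_zero]
  rw [h2]
  refine (abs_real_inner_le_norm _ _).trans ?_
  rwa [hN.1, one_mul]

/-- The linearization error is at most half the immersion bound, so ‖S ξ - S η‖ ≥ (κ/2)‖ξ - η‖;
Cramer's rule bounds the left side by the adapted coordinates. -/
theorem IsRegularParam.norm_sub_le_coordConst (h : IsRegularParam 2 A κ ρ V U S) (hκ : 0 < κ)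
    (hν : 0 < ν) (hAδ : A * δ ≤ κ / 2) (hPU : P ⊆ U) (hP : ∀ ξ ∈ P, ∀ η ∈ P, ‖ξ - η‖ ≤ δ)
    {N : Fin (n + 1) → Euc (n + 1)} (hN : ∀ i, ‖N i‖ = 1)
    (hdet : ν ≤ |(Matrix.of fun i j => N i j).det|) (hξ : ξ ∈ P) (hη : η ∈ P) {t : ℝ}
    (ht : ∀ j, |inner ℝ (N j) (S ξ) - inner ℝ (N j) (S η)| ≤ t) :
    ‖ξ - η‖ ≤ coordConst n κ ν * t := by
  have h1 := h.norm_sub_sub_le (h.subset (hPU hξ)) (h.subset (hPU hξ)) (h.subset (hPU hη))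
    (hP ξ hξ ξ hξ) (hP η hη ξ hξ)
  have h2 := h.immersion ξ (hPU hξ) (ξ - η)
  have h3 : ‖S ξ - S η‖ ≤ (n + 1 : ℕ) * cramerConst (n + 1) ν * t :=
    norm_le_of_abs_inner_le hN hν hdet fun j => by rw [inner_sub_right]; exact ht j
  have h4 : ‖fderiv ℝ S ξ (ξ - η)‖ ≤ ‖S ξ - S η‖ + ‖S ξ - S η - fderiv ℝ S ξ (ξ - η)‖ := by
    have := norm_sub_le (S ξ - S η) (S ξ - S η - fderiv ℝ S ξ (ξ - η))
    rwa [sub_sub_cancel] at this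
  have h5 : A * δ * ‖ξ - η‖ ≤ κ / 2 * ‖ξ - η‖ := by gcongr
  have h6 : κ / 2 * ‖ξ - η‖ ≤ (n + 1 : ℕ) * cramerConst (n + 1) ν * t := by linarith
  calc ‖ξ - η‖ = 2 / κ * (κ / 2 * ‖ξ - η‖) := by field_simp
    _ ≤ 2 / κ * ((n + 1 : ℕ) * cramerConst (n + 1) ν * t) := by gcongr
    _ = _ := by rw [coordConst]; ring

end

theorem MeasureTheory.IntegrableOn.continuous_extension {n : ℕ} {P : Set (Euc n)}
    {S : Euc n → Euc (n + 1)} {f : Euc n → ℂ} (hS : ContinuousOn S P) (hP : MeasurableSet P)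
    (hf : IntegrableOn f P) :
    Continuous fun x => ∫ ξ in P, Complex.exp (Complex.I * ((inner ℝ x (S ξ) : ℝ) : ℂ)) * f ξ := by
  refine continuous_of_dominated (bound := fun ξ => ‖f ξ‖) (fun x => ?_) (fun x => ?_) hf.norm ?_
  · refine AEStronglyMeasurable.mul ?_ hf.aestronglyMeasurable
    exact ContinuousOn.aestronglyMeasurable (by fun_prop) hP
  · refine Eventually.of_forall fun ξ => ?_
    rw [norm_mul, mul_comm Complex.I, Complex.norm_exp_ofReal_mul_I, one_mul]
  · exact Eventually.of_forall fun ξ => by fun_prop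

/-- The multilinear estimate for small pieces of the surfaces. -/
theorem exists_multilinear_piece_estimate {n k d : ℕ} (hk : 2 ≤ k) (hkn : k ≤ n + 1)
    (hd : k + d = n + 1) (i₁ : Fin k) (m : ℕ) {A κ ν : ℝ} (hA : 0 < A) (hκ : 0 < κ) (hν : 0 < ν) :
    ∃ C : ℝ, 0 ≤ C ∧ ∀ (ρ : ℝ) (V U : Fin k → Set (Euc n)) (S : Fin k → Euc n → Euc (n + 1))
      (H : AffineSubspace ℝ (Euc (n + 1))) (μ : ℝ), 0 < μ →
      (∀ i, IsRegularParam 2 A κ ρ (V i) (U i) (S i)) →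
      SmallSupportCondition hkn i₁ ν μ H U S →
      ∀ q : ℝ, 1 ≤ q → ∀ P : Fin k → Set (Euc n), (∀ i, MeasurableSet (P i)) →
      (∀ i, P i ⊆ U i) → (∀ i, ∀ ξ ∈ P i, ∀ η ∈ P i, ‖ξ - η‖ ≤ pieceSize n A κ ν / q) →
      ∀ f : Fin k → Euc n → ℂ, (∀ i, IntegrableOn (f i) (P i)) →
      ∀ R : ℝ, cramerConst (n + 1) ν * R ≤ q ^ m →
      ∫⁻ x in Metric.ball 0 R, ∏ i, (‖∫ ξ in P i,
          Complex.exp (Complex.I * ((inner ℝ x (S i ξ) : ℝ) : ℂ)) * f i ξ‖ₑ ^ 2) ^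
            (1 / ((k : ℝ) - 1)) ≤
        ENNReal.ofReal (C * μ ^ ((d : ℝ) / (k - 1))) *
          ∏ i, (∫⁻ ξ in P i, ‖f i ξ‖ₑ ^ 2) ^ (1 / ((k : ℝ) - 1)) := by
  classical
  have hk1 : (0 : ℝ) < (k : ℝ) - 1 := by
    have : (2 : ℝ) ≤ k := by exact_mod_cast hk
    linarith
  have hp : 0 < 1 / ((k : ℝ) - 1) := by positivity
  have hpi := Real.pi_pos
  set Kc : ℝ≥0∞ := ((((Fintype.piFinset fun _ : Fin k ⊕ Fin d =>
    Finset.Icc ⌊-(1 * A)⌋ ⌊1 * A⌋).card : ℕ) : ℝ≥0∞) *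
      (monomConst (Fin k ⊕ Fin d) 1 * monomConst (Fin k ⊕ Fin d) 2) ^ m) ^ ((k : ℝ) / (k - 1)) *
        ENNReal.ofReal (stepConst k d ^ m * (2 * (m + 1)) ^ (k + d)) with hKc
  have hKt : Kc ≠ ⊤ := by
    refine ENNReal.mul_ne_top (ENNReal.rpow_ne_top_of_nonneg (by positivity) ?_) ENNReal.ofReal_ne_top
    exact ENNReal.mul_ne_top (ENNReal.natCast_ne_top _) (ENNReal.pow_ne_top
      (ENNReal.mul_ne_top (monomConst_ne_top _) (monomConst_ne_top _)))
  set c := coordConst n κ ν with hc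
  have hc0 : 0 < c := coordConst_pos n hκ hν
  -- The factorial is the Jacobian bound, `Kc` comes from the m steps of the induction, and the rest
  -- from the volumes of the cells.
  refine ⟨(n + 1).factorial * (Kc.toReal *
    (((c ^ n) ^ k) ^ (1 / ((k : ℝ) - 1)) * 2 ^ (k + d) * 4 ^ ((d : ℝ) / (k - 1)))), by positivity, ?_⟩
  intro ρ V U S H μ hμ hreg hcond q hq P hPm hPU hPδ f hf R hR
  by_cases hne : ∀ i, (P i).Nonempty
  swap
  · push Not at hne
    obtain ⟨i, hi⟩ := hne
    have h0 : ∀ x : Euc (n + 1), ∏ i, (‖∫ ξ in P i,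
          Complex.exp (Complex.I * ((inner ℝ x (S i ξ) : ℝ) : ℂ)) * f i ξ‖ₑ ^ 2) ^
            (1 / ((k : ℝ) - 1)) = 0 := fun x =>
      Finset.prod_eq_zero (Finset.mem_univ i) (by simp [hi, hk1])
    simp only [h0, lintegral_zero]
    exact zero_le
  choose ξ₀ hξ₀ using hne
  have hq0 : 0 < q := one_pos.trans_le hq
  have hQ : 0 < q ^ m := by positivity
  set δ := pieceSize n A κ ν / q with hδ
  -- The two terms of `pieceSize` serve two purposes: the first lets the adapted coordinates control
  -- the parameters, the second makes the own coordinate slower by the factor q.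
  have hδ1 : A * δ ≤ κ / 2 := by
    have h1 : pieceSize n A κ ν ≤ κ / (2 * A) := min_le_left _ _
    calc A * δ ≤ A * (κ / (2 * A)) := by
          gcongr
          exact (div_le_self (pieceSize_pos n hA hκ hν).le hq).trans h1
      _ = κ / 2 := by field_simp
  have hδ2 : q * (A * δ * c) ≤ 1 / 2 := by
    have h1 : pieceSize n A κ ν ≤ 1 / (2 * (A * c)) := min_le_right _ _
    calc q * (A * δ * c) = A * pieceSize n A κ ν * c := by rw [hδ]; field_simp
      _ ≤ A * (1 / (2 * (A * c))) * c := by gcongr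
      _ = 1 / 2 := by field_simp
  have hδ3 : A * δ * c ≤ 1 / 2 := by
    have h1 : 0 ≤ A * δ * c := by
      have := pieceSize_pos n hA hκ hν
      positivity
    nlinarith
  choose N₁ hN₁ using fun i => exists_isUnitNormal (S i) (ξ₀ i)
  obtain ⟨N, hNN₁, hNo, hNspan⟩ := exists_completion hd hkn H.directionᗮ (by
    have h1 := H.direction.finrank_add_finrank_orthogonal
    rw [hcond.finrank_eq, finrank_euclideanSpace_fin] at h1
    omega) N₁
  have hdet : ν ≤ |(Matrix.of fun i j => N i j).det| :=
    hcond.det_ge ξ₀ N (fun i => hPU i (hξ₀ i)) (fun i => by rw [hNN₁]; exact hN₁ i) hNo hNspan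
  have hNnorm : ∀ j, ‖N j‖ = 1 := by
    intro j
    by_cases hj : (j : ℕ) < k
    · have h1 := hNN₁ ⟨j, hj⟩
      have h2 : Fin.castLE hkn ⟨(j : ℕ), hj⟩ = j := rfl
      rw [h2] at h1
      rw [h1]
      exact (hN₁ _).1
    · exact hNo.1 ⟨j, not_lt.1 hj⟩
  set e : Fin k ⊕ Fin d ≃ Fin (n + 1) := finSumFinEquiv.trans (finCongr hd) with he
  have hel : ∀ i, e (Sum.inl i) = Fin.castLE hkn i := fun i => by
    ext; simp [he]
  have her : ∀ l, k ≤ (e (Sum.inr l) : ℕ) := fun l => by simp [he]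
  set s₀ : Fin k → Euc n → Fin k ⊕ Fin d → ℝ := fun i ξ j => inner ℝ (N (e j)) (S i ξ) with hs₀
  -- A retraction onto the piece makes the bounds on the coordinates valid at every parameter,
  -- without changing integrals over the piece.
  set pr : Fin k → Euc n → Euc n := fun i ξ => if ξ ∈ P i then ξ else ξ₀ i with hpr
  have hprP : ∀ i ξ, pr i ξ ∈ P i := fun i ξ => by
    simp only [hpr]
    split_ifs with h
    exacts [h, hξ₀ i]
  have hprid : ∀ i, ∀ ξ ∈ P i, pr i ξ = ξ := fun i ξ h => if_pos h
  set s : Fin k → Euc n → Fin k ⊕ Fin d → ℝ := fun i ξ => s₀ i (pr i ξ) with hs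
  have hScont : ∀ i, ContinuousOn (S i) (P i) := fun i =>
    (hreg i).smooth.continuousOn.mono ((hPU i).trans (hreg i).subset)
  have hsm : ∀ i, Measurable (s i) := by
    intro i
    have h1 : s i = (P i).piecewise (s₀ i) fun _ => s₀ i (ξ₀ i) := by
      funext ξ
      simp only [hs, hpr, Set.piecewise]
      split_ifs <;> rfl
    rw [h1]
    refine ContinuousOn.measurable_piecewise ?_ continuousOn_const (hPm i)
    exact continuousOn_pi.2 fun j => ContinuousOn.inner continuousOn_const (hScont i)
  have hsB : ∀ i ξ j, |s i ξ j| ≤ A := by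
    intro i ξ j
    refine (abs_real_inner_le_norm _ _).trans ?_
    rw [hNnorm, one_mul, ← norm_iteratedFDeriv_zero (𝕜 := ℝ)]
    exact (hreg i).deriv_bound 0 (by norm_num) _ ((hreg i).subset (hPU i (hprP i ξ)))
  have hflat : ∀ i, ∀ ξ ∈ P i, ∀ η ∈ P i,
      |s₀ i ξ (Sum.inl i) - s₀ i η (Sum.inl i)| ≤ A * δ * ‖ξ - η‖ := by
    intro i ξ hξ η hη
    simp only [hs₀]
    rw [hel, hNN₁]
    exact (hreg i).abs_inner_normal_sub_le (hPU i) (hPδ i) (hξ₀ i) (hN₁ i) hξ hη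
  have hcoord : ∀ i, ∀ ξ ∈ P i, ∀ η ∈ P i, ∀ t, (∀ j, |s₀ i ξ j - s₀ i η j| ≤ t) →
      ‖ξ - η‖ ≤ c * t := by
    intro i ξ hξ η hη t ht
    refine (hreg i).norm_sub_le_coordConst hκ hν hδ1 (hPU i) (hPδ i) hNnorm hdet hξ hη fun j => ?_
    have := ht (e.symm j)
    simpa only [hs₀, e.apply_symm_apply] using this
  have hsmall₀ : ∀ ξ ∈ P i₁, ∀ η ∈ P i₁, ∀ l,
      |s₀ i₁ ξ (Sum.inr l) - s₀ i₁ η (Sum.inr l)| ≤ 2 * μ := by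
    intro ξ hξ η hη l
    refine abs_inner_sub_inner_le_of_mem_cthickening (hNnorm _) ?_
      (hcond.near ξ (hPU _ hξ)) (hcond.near η (hPU _ hη)) hμ
    rw [← hNspan]
    exact Submodule.subset_span ⟨⟨e (Sum.inr l), her l⟩, rfl⟩
  have hAδ0 : 0 ≤ A * δ := by
    have := pieceSize_pos n hA hκ hν
    positivity
  have hown : ∀ i ξ η r, (∀ j, |s i ξ j - s i η j| ≤ r) →
      q * |s i ξ (Sum.inl i) - s i η (Sum.inl i)| ≤ 2 * r := by
    intro i ξ η r h
    have h1 := hcoord i _ (hprP i ξ) _ (hprP i η) r h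
    have h2 := hflat i _ (hprP i ξ) _ (hprP i η)
    have hr : 0 ≤ r := (abs_nonneg _).trans (h (Sum.inl i))
    calc q * |s i ξ (Sum.inl i) - s i η (Sum.inl i)| ≤ q * (A * δ * (c * r)) := by
          gcongr
          exact h2.trans (by gcongr)
      _ = q * (A * δ * c) * r := by ring
      _ ≤ 2 * r := by gcongr; linarith
  set v : Fin k → ℝ := fun i => c ^ n * ((2 / q ^ m) ^ (k - 1) *
      if i = i₁ then (2 * min (1 / q ^ m) (2 * μ)) ^ d else (2 / q ^ m) ^ d) with hv
  have hv0 : ∀ i, 0 ≤ v i := by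
    intro i
    have h1 := lt_min (a := (0 : ℝ)) (b := 1 / q ^ m) (c := 2 * μ) (by positivity) (by positivity)
    simp only [hv]
    split_ifs <;> positivity
  have hvol : ∀ i θ, (volume.restrict (P i)) (cellSet (s i) (q ^ m) θ) ≤ ENNReal.ofReal (v i) := by
    intro i θ
    rw [Measure.restrict_apply (measurableSet_cellSet _ (hsm i) θ)]
    refine volume_inter_cellSet_le hd i i₁ (s₀ := s₀ i) (fun ξ hξ => ?_) hc0 hQ (hcoord i)
      (fun ξ hξ η hη => ?_) (fun hi ξ hξ η hη l => ?_) hμ θ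
    · simp only [hs, hprid i ξ hξ]
    · calc c * |s₀ i ξ (Sum.inl i) - s₀ i η (Sum.inl i)| ≤ c * (A * δ * ‖ξ - η‖) := by
            gcongr
            exact hflat i ξ hξ η hη
        _ = A * δ * c * ‖ξ - η‖ := by ring
        _ ≤ 1 / 2 * ‖ξ - η‖ := by gcongr
    · subst hi
      exact hsmall₀ ξ hξ η hη l
  have main := lintegral_prod_expo_le hk i₁ hsm hsB hq hμ le_rfl hown
    (fun ξ η l => hsmall₀ _ (hprP i₁ ξ) _ (hprP i₁ η) l) (ν := fun i => volume.restrict (P i))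
    (f := f) hf m hvol
  have hFm : Measurable fun x : Euc (n + 1) => ∏ i, (‖∫ ξ in P i,
      Complex.exp (Complex.I * ((inner ℝ x (S i ξ) : ℝ) : ℂ)) * f i ξ‖ₑ ^ 2) ^
        (1 / ((k : ℝ) - 1)) :=
    Finset.measurable_fun_prod _ fun i _ =>
      (((hf i).continuous_extension (hScont i) (hPm i)).measurable.enorm.pow_const 2).pow_const _
  have hphase : ∀ (τ : Fin k ⊕ Fin d → ℝ) i, ∫ ξ in P i, Complex.exp (Complex.I *
      ((inner ℝ (∑ j, τ j • N (e j)) (S i ξ) : ℝ) : ℂ)) * f i ξ =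
      ∫ ξ in P i, expo τ (s i ξ) * f i ξ := by
    intro τ i
    refine setIntegral_congr_fun (hPm i) fun ξ hξ => ?_
    simp only [hs, hprid i ξ hξ, hs₀, expo, sum_inner, inner_smul_left, RCLike.conj_to_real]
  refine (lintegral_ball_le_lintegral_box e hNnorm hν hdet hFm R).trans ?_
  simp only [hphase]
  have hprod : (∏ i, (ENNReal.ofReal (v i) * ∫⁻ ξ in P i, ‖f i ξ‖ₑ ^ 2) ^ (1 / ((k : ℝ) - 1))) =
      ENNReal.ofReal (∏ i, v i ^ (1 / ((k : ℝ) - 1))) *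
        ∏ i, (∫⁻ ξ in P i, ‖f i ξ‖ₑ ^ 2) ^ (1 / ((k : ℝ) - 1)) := by
    simp only [ENNReal.mul_rpow_of_nonneg _ _ hp.le, Finset.prod_mul_distrib]
    rw [ENNReal.ofReal_prod_of_nonneg fun i _ => Real.rpow_nonneg (hv0 i) _]
    simp only [fun i => ENNReal.ofReal_rpow_of_nonneg (hv0 i) hp.le]
  calc _ ≤ ((n + 1).factorial : ℝ≥0∞) * (Kc *
        ENNReal.ofReal (max 1 (q ^ m * μ) ^ ((d : ℝ) / (k - 1)) * (q ^ m) ^ (k + d)) *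
        ∏ i, (ENNReal.ofReal (v i) * ∫⁻ ξ in P i, ‖f i ξ‖ₑ ^ 2) ^ (1 / ((k : ℝ) - 1))) := by
        gcongr
        exact (lintegral_mono_set (box_mono _ hR)).trans main
    _ = ((n + 1).factorial : ℝ≥0∞) * Kc *
        ENNReal.ofReal ((max 1 (q ^ m * μ) ^ ((d : ℝ) / (k - 1)) * (q ^ m) ^ (k + d)) *
          ∏ i, v i ^ (1 / ((k : ℝ) - 1))) *
        ∏ i, (∫⁻ ξ in P i, ‖f i ξ‖ₑ ^ 2) ^ (1 / ((k : ℝ) - 1)) := by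
        rw [hprod, ENNReal.ofReal_mul (p := max 1 (q ^ m * μ) ^ ((d : ℝ) / (k - 1)) *
          (q ^ m) ^ (k + d)) (by positivity)]
        ring
    _ ≤ ((n + 1).factorial : ℝ≥0∞) * Kc *
        ENNReal.ofReal (((c ^ n) ^ k) ^ (1 / ((k : ℝ) - 1)) * 2 ^ (k + d) *
          4 ^ ((d : ℝ) / (k - 1)) * μ ^ ((d : ℝ) / (k - 1))) *
        ∏ i, (∫⁻ ξ in P i, ‖f i ξ‖ₑ ^ 2) ^ (1 / ((k : ℝ) - 1)) := by
        gcongr _ * ENNReal.ofReal ?_ * _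
        exact prod_piece_volume_le hk i₁ hc0 hQ hμ
    _ = _ := by
        congr 1
        rw [← ENNReal.ofReal_toReal hKt, ← ENNReal.ofReal_natCast, ← ENNReal.ofReal_mul
          (by positivity), ← ENNReal.ofReal_mul (by positivity)]
        rw [ENNReal.toReal_ofReal ENNReal.toReal_nonneg]
        congr 1
        ring

/-! ### Summation over the pieces -/

theorem IsRegularParam.mono {n M : ℕ} {A A' κ ρ : ℝ} {V U : Set (Euc n)}
    {S : Euc n → Euc (n + 1)} (h : IsRegularParam M A κ ρ V U S) (hA : A ≤ A') :
    IsRegularParam M A' κ ρ V U S :=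
  { h with deriv_bound := fun m hm ξ hξ => (h.deriv_bound m hm ξ hξ).trans hA }

/-- Comparison with the largest term works for every positive exponent, whether the power is convex
or concave; 2/(k-1) can be on either side of 1. -/
theorem ENNReal.sum_rpow_le_card_rpow_mul_sum {ι : Type*} (T : Finset ι) (a : ι → ℝ≥0∞) {r : ℝ}
    (hr : 0 < r) : (∑ θ ∈ T, a θ) ^ r ≤ (T.card : ℝ≥0∞) ^ r * ∑ θ ∈ T, a θ ^ r := by
  rcases T.eq_empty_or_nonempty with rfl | hT
  · simp [hr]
  obtain ⟨θ₀, hθ₀, hmax⟩ := T.exists_max_image a hT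
  calc (∑ θ ∈ T, a θ) ^ r ≤ (T.card * a θ₀) ^ r := by
        gcongr
        rw [← nsmul_eq_mul]
        exact Finset.sum_le_card_nsmul _ _ _ hmax
    _ = (T.card : ℝ≥0∞) ^ r * a θ₀ ^ r := ENNReal.mul_rpow_of_nonneg _ _ hr.le
    _ ≤ _ := by
        gcongr
        exact Finset.single_le_sum (f := fun θ => a θ ^ r) (fun _ _ => zero_le) hθ₀

theorem card_Icc_floor_le {x : ℝ} (hx : 0 ≤ x) :
    ((Finset.Icc ⌊-x⌋ ⌊x⌋).card : ℝ) ≤ 2 * x + 2 := by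
  rw [Int.card_Icc]
  have h1 : ⌊-x⌋ ≤ ⌊x⌋ := Int.floor_le_floor (by linarith)
  have h2 : (((⌊x⌋ + 1 - ⌊-x⌋).toNat : ℤ) : ℝ) = ((⌊x⌋ + 1 - ⌊-x⌋ : ℤ) : ℝ) := by
    rw [Int.toNat_of_nonneg (by omega)]
  rw [← Int.cast_natCast, h2]
  push_cast
  linarith [Int.floor_le x, Int.lt_floor_add_one (-x)]

/-- The multilinear estimate, with the loss expressed by the number of pieces. -/
theorem exists_lintegral_multilinear_le {n k d : ℕ} (hk : 2 ≤ k) (hkn : k ≤ n + 1)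
    (hd : k + d = n + 1) (hn : 0 < n) (i₁ : Fin k) (m : ℕ) {A κ ρ ν : ℝ} (hA : 0 < A) (hκ : 0 < κ)
    (hρ : 0 < ρ) (hν : 0 < ν) :
    ∃ C B : ℝ, 0 ≤ C ∧ 0 ≤ B ∧ ∀ (V U : Fin k → Set (Euc n)) (S : Fin k → Euc n → Euc (n + 1))
      (H : AffineSubspace ℝ (Euc (n + 1))) (μ : ℝ), 0 < μ →
      (∀ i, IsRegularParam 2 A κ ρ (V i) (U i) (S i)) →
      SmallSupportCondition hkn i₁ ν μ H U S →
      ∀ q : ℝ, 1 ≤ q → ∀ f : Fin k → Euc n → ℂ, (∀ i, IntegrableOn (f i) (U i)) →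
      ∀ R : ℝ, cramerConst (n + 1) ν * R ≤ q ^ m →
      ∫⁻ x in Metric.ball 0 R, ∏ i, (‖extensionOp (U i) (S i) (f i) x‖ₑ ^ 2) ^
            (1 / ((k : ℝ) - 1)) ≤
        ENNReal.ofReal (((B * q) ^ n) ^ ((2 / ((k : ℝ) - 1) + 1) * k) *
            (C * μ ^ ((d : ℝ) / (k - 1)))) *
          ∏ i, (∫⁻ ξ in U i, ‖f i ξ‖ₑ ^ 2) ^ (1 / ((k : ℝ) - 1)) := by
  have hk1 : (0 : ℝ) < (k : ℝ) - 1 := by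
    have : (2 : ℝ) ≤ k := by exact_mod_cast hk
    linarith
  set p := 1 / ((k : ℝ) - 1) with hpdef
  have hp : 0 < p := by positivity
  obtain ⟨C, hC, hpiece⟩ := exists_multilinear_piece_estimate hk hkn hd i₁ m hA hκ hν
  have hδ := pieceSize_pos n hA hκ hν
  set δ := pieceSize n A κ ν with hδdef
  refine ⟨C, 2 * (n / δ * ρ) + 2, hC, by positivity, ?_⟩
  intro V U S H μ hμ hreg hcond q hq f hf R hR
  have hq0 : 0 < q := one_pos.trans_le hq
  -- Lattice cells of side 1/lam have diameter at most n/lam = δ/q, as required of a piece.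
  set lam : ℝ := n * q / δ with hlam
  have hn0 : (0 : ℝ) < n := by exact_mod_cast hn
  have hlam0 : 0 < lam := by positivity
  classical
  set g : Fin k → Euc n → Fin n → ℝ := fun i => (U i).piecewise (fun ξ => ξ.ofLp) fun _ => 0 with hg
  have hUm : ∀ i, MeasurableSet (U i) := fun i => (hreg i).isOpen.measurableSet
  have hgm : ∀ i, Measurable (g i) := fun i =>
    Measurable.piecewise (hUm i) (MeasurableEquiv.toLp 2 (Fin n → ℝ)).symm.measurable
      measurable_const
  have hgU : ∀ i, ∀ ξ ∈ U i, g i ξ = ξ.ofLp := fun i ξ hξ => Set.piecewise_eq_of_mem _ _ _ hξ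
  have hgB : ∀ i ξ j, |g i ξ j| ≤ ρ := by
    intro i ξ j
    by_cases hξ : ξ ∈ U i
    · rw [hgU i ξ hξ]
      exact (PiLp.norm_apply_le ξ j).trans
        (mem_ball_zero_iff.1 ((hreg i).subset_ball hξ)).le
    · simp only [hg]
      rw [Set.piecewise_eq_of_notMem _ _ _ hξ]
      simpa using hρ.le
  set T := Fintype.piFinset fun _ : Fin n => Finset.Icc ⌊-(lam * ρ)⌋ ⌊lam * ρ⌋ with hT
  have hTcard : (T.card : ℝ) ≤ ((2 * (n / δ * ρ) + 2) * q) ^ n := by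
    rw [hT, Fintype.card_piFinset]
    simp only [Finset.prod_const, Finset.card_univ, Fintype.card_fin]
    push_cast
    gcongr
    refine (card_Icc_floor_le (by positivity)).trans ?_
    have : lam * ρ = n / δ * ρ * q := by rw [hlam]; ring
    rw [this]
    nlinarith
  set F : Fin k → (Fin n → ℤ) → Euc (n + 1) → ℂ := fun i θ x => ∫ ξ in cellSet (g i) lam θ ∩ U i,
    Complex.exp (Complex.I * ((inner ℝ x (S i ξ) : ℝ) : ℂ)) * f i ξ with hF
  have hScont : ∀ i, ContinuousOn (S i) (U i) := fun i =>
    (hreg i).smooth.continuousOn.mono (hreg i).subset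
  have hPm : ∀ i θ, MeasurableSet (cellSet (g i) lam θ ∩ U i) := fun i θ =>
    (measurableSet_cellSet lam (hgm i) θ).inter (hUm i)
  have hFm : ∀ i θ, Measurable fun x => (‖F i θ x‖ₑ ^ 2) ^ p := fun i θ =>
    ((((hf i).mono_set inter_subset_right).continuous_extension
      ((hScont i).mono inter_subset_right) (hPm i θ)).measurable.enorm.pow_const 2).pow_const _
  have hE : ∀ i x, extensionOp (U i) (S i) (f i) x = ∑ θ ∈ T, F i θ x := by
    intro i x
    have hint : IntegrableOn (fun ξ =>
        Complex.exp (Complex.I * ((inner ℝ x (S i ξ) : ℝ) : ℂ)) * f i ξ) (U i) := by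
      refine (hf i).bdd_mul (c := 1) ?_ ?_
      · have := hScont i
        exact ContinuousOn.aestronglyMeasurable (by fun_prop) (hUm i)
      · refine Eventually.of_forall fun ξ => ?_
        rw [mul_comm Complex.I, Complex.norm_exp_ofReal_mul_I]
    rw [extensionOp, integral_eq_sum_cellSet (hgB i) hlam0 (hgm i) hint]
    refine Finset.sum_congr rfl fun θ _ => ?_
    rw [Measure.restrict_restrict (measurableSet_cellSet lam (hgm i) θ)]
  -- Each of the k factors costs the power 2/(k-1) of the number of pieces; the later sum over
  -- k-tuples of pieces costs its k-th power.
  have hpt : ∀ x, ∏ i, (‖extensionOp (U i) (S i) (f i) x‖ₑ ^ 2) ^ p ≤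
      (T.card : ℝ≥0∞) ^ (2 / ((k : ℝ) - 1) * k) *
        ∑ Θ ∈ Fintype.piFinset fun _ : Fin k => T, ∏ i, (‖F i (Θ i) x‖ₑ ^ 2) ^ p := by
    intro x
    have h2p : ∀ y : ℝ≥0∞, (y ^ 2) ^ p = y ^ (2 / ((k : ℝ) - 1)) := fun y => by
      rw [← ENNReal.rpow_natCast, ← ENNReal.rpow_mul]
      congr 1
      rw [hpdef]
      push_cast
      ring
    rw [← Finset.prod_univ_sum (fun _ : Fin k => T) (fun i θ => (‖F i θ x‖ₑ ^ 2) ^ p)]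
    have hcard : (T.card : ℝ≥0∞) ^ (2 / ((k : ℝ) - 1) * k) =
        ∏ _i : Fin k, (T.card : ℝ≥0∞) ^ (2 / ((k : ℝ) - 1)) := by
      rw [Finset.prod_const, Finset.card_univ, Fintype.card_fin, ENNReal.rpow_mul,
        ENNReal.rpow_natCast]
    rw [hcard, ← Finset.prod_mul_distrib]
    refine Finset.prod_le_prod' fun i _ => ?_
    simp only [h2p, hE]
    refine (ENNReal.rpow_le_rpow (enorm_sum_le T _) (by positivity)).trans ?_
    exact ENNReal.sum_rpow_le_card_rpow_mul_sum T _ (by positivity)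
  have hTt : (T.card : ℝ≥0∞) ^ (2 / ((k : ℝ) - 1) * k) ≠ ⊤ :=
    ENNReal.rpow_ne_top_of_nonneg (by positivity) (ENNReal.natCast_ne_top _)
  set I := ∏ i, (∫⁻ ξ in U i, ‖f i ξ‖ₑ ^ 2) ^ p with hI
  have hterm : ∀ Θ : Fin k → Fin n → ℤ, ∫⁻ x in Metric.ball 0 R,
      ∏ i, (‖F i (Θ i) x‖ₑ ^ 2) ^ p ≤ ENNReal.ofReal (C * μ ^ ((d : ℝ) / (k - 1))) * I := by
    intro Θ
    refine (hpiece ρ V U S H μ hμ hreg hcond q hq (fun i => cellSet (g i) lam (Θ i) ∩ U i)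
      (fun i => hPm i _) (fun i => inter_subset_right) ?_ f
      (fun i => (hf i).mono_set inter_subset_right) R hR).trans ?_
    · intro i ξ hξ η hη
      have h1 : cell lam (g i ξ) = Θ i := hξ.1
      have h2 : cell lam (g i η) = Θ i := hη.1
      have h3 : ‖ξ - η‖ ≤ n * (1 / lam) := norm_le_of_abs_le fun j => by
        have := abs_sub_le_of_cell_eq hlam0 (h1.trans h2.symm) j
        rwa [hgU i ξ hξ.2, hgU i η hη.2] at this
      refine h3.trans_eq ?_
      rw [hlam]
      field_simp
    · rw [hI]
      gcongr with i
      exact inter_subset_right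
  calc _ ≤ ∫⁻ x in Metric.ball 0 R, (T.card : ℝ≥0∞) ^ (2 / ((k : ℝ) - 1) * k) *
        ∑ Θ ∈ Fintype.piFinset fun _ : Fin k => T, ∏ i, (‖F i (Θ i) x‖ₑ ^ 2) ^ p :=
        lintegral_mono hpt
    _ = (T.card : ℝ≥0∞) ^ (2 / ((k : ℝ) - 1) * k) *
        ∑ Θ ∈ Fintype.piFinset fun _ : Fin k => T,
          ∫⁻ x in Metric.ball 0 R, ∏ i, (‖F i (Θ i) x‖ₑ ^ 2) ^ p := by
        rw [lintegral_const_mul' _ _ hTt, lintegral_finsetSum _ fun Θ _ =>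
          Finset.measurable_fun_prod _ fun i _ => hFm i (Θ i)]
    _ ≤ (T.card : ℝ≥0∞) ^ (2 / ((k : ℝ) - 1) * k) * ((T.card : ℝ≥0∞) ^ k *
          (ENNReal.ofReal (C * μ ^ ((d : ℝ) / (k - 1))) * I)) := by
        gcongr
        refine (Finset.sum_le_card_nsmul _ _ _ fun Θ _ => hterm Θ).trans_eq ?_
        rw [nsmul_eq_mul, Fintype.card_piFinset]
        simp only [Finset.prod_const, Finset.card_univ, Fintype.card_fin]
        push_cast
        ring
    _ = (T.card : ℝ≥0∞) ^ ((2 / ((k : ℝ) - 1) + 1) * k) *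
          (ENNReal.ofReal (C * μ ^ ((d : ℝ) / (k - 1))) * I) := by
        rw [← mul_assoc, add_mul, one_mul, ENNReal.rpow_add_of_nonneg _ _ (by positivity)
          (by positivity), ENNReal.rpow_natCast]
    _ ≤ _ := by
        have hcard : (T.card : ℝ≥0∞) ≤ ENNReal.ofReal (((2 * (n / δ * ρ) + 2) * q) ^ n) := by
          rw [← ENNReal.ofReal_natCast]
          exact ENNReal.ofReal_le_ofReal hTcard
        rw [ENNReal.ofReal_mul (p := (((2 * (n / δ * ρ) + 2) * q) ^ n) ^
            ((2 / ((k : ℝ) - 1) + 1) * k)) (by positivity),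
          ← ENNReal.ofReal_rpow_of_nonneg (x := ((2 * (n / δ * ρ) + 2) * q) ^ n) (by positivity)
          (by positivity), mul_assoc]
        exact mul_le_mul_left (ENNReal.rpow_le_rpow hcard (by positivity)) _

/-! ### Choice of the number of scales -/

theorem mainTheorem2 (n k : ℕ) (hk2 : 2 ≤ k) (hkn : k < n + 1) (ε : ℝ) (hε : 0 < ε) :
    ∃ M : ℕ, ∀ A κ ρ ν : ℝ, 0 < κ → 0 < ρ → 0 < ν →
      ∃ C : ℝ, 0 < C ∧
        ∀ (V U : Fin k → Set (Euc n)) (S : Fin k → Euc n → Euc (n + 1))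
          (H : AffineSubspace ℝ (Euc (n + 1))) (μ : ℝ),
          0 < μ →
          (∀ i, IsRegularParam M A κ ρ (V i) (U i) (S i)) →
          Transversal ν U S →
          SmallSupportCondition hkn.le ⟨0, by omega⟩ ν μ H U S →
          ∀ (R : ℝ), 1 ≤ R →
          ∀ f : Fin k → Euc n → ℂ,
            (∀ i, MeasureTheory.MemLp (f i) 2 (MeasureTheory.volume.restrict (U i))) →
            MeasureTheory.eLpNorm (fun x => ∏ i, extensionOp (U i) (S i) (f i) x)
                (ENNReal.ofReal (2 / ((k : ℝ) - 1)))
                (MeasureTheory.volume.restrict (Metric.ball (0 : Euc (n + 1)) R))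
              ≤ ENNReal.ofReal (C * μ ^ (((n : ℝ) + 1 - k) / 2) * R ^ ε) *
                ∏ i, MeasureTheory.eLpNorm (f i) 2 (MeasureTheory.volume.restrict (U i)) := by
  refine ⟨2, fun A κ ρ ν hκ hρ hν => ?_⟩
  have hk1 : (0 : ℝ) < (k : ℝ) - 1 := by
    have : (2 : ℝ) ≤ k := by exact_mod_cast hk2
    linarith
  set d := n + 1 - k with hd
  have hkd : k + d = n + 1 := by omega
  have hdcast : (n : ℝ) + 1 - k = d := by
    have : (k : ℝ) + d = n + 1 := by exact_mod_cast hkd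
    linarith
  set r : ℝ := ((k : ℝ) - 1) / 2 with hr
  have hr0 : 0 < r := by positivity
  set E : ℝ := n * (((2 / ((k : ℝ) - 1) + 1) * k) * r) with hE
  have hE0 : 0 ≤ E := by positivity
  -- E is the power of q lost in counting pieces, after the final root. With q^m a multiple of R,
  -- the loss is R^(E/m), which is at most R^ε.
  obtain ⟨m, hm⟩ := exists_nat_gt (E / ε)
  have hm0 : (0 : ℝ) < m := (div_nonneg hE0 hε.le).trans_lt hm
  have hEm : E / m ≤ ε := by
    rw [div_lt_iff₀ hε] at hm
    rw [div_le_iff₀ hm0]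
    linarith
  obtain ⟨C, B, hC, hB, hmain⟩ := exists_lintegral_multilinear_le hk2 hkn.le hkd (by omega)
    (⟨0, by omega⟩ : Fin k) m (lt_max_of_lt_right one_pos : 0 < max A 1) hκ hρ hν
  set L := max 1 (cramerConst (n + 1) ν) with hL
  have hL0 : 1 ≤ L := le_max_left _ _
  -- The summand 1 only ensures strict positivity.
  refine ⟨B ^ E * C ^ r * L ^ ε + 1, by positivity, ?_⟩
  intro V U S H μ hμ hreg _ hcond R hR f hf
  have hLR : 1 ≤ L * R := one_le_mul_of_one_le_of_one_le hL0 hR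
  set q := (L * R) ^ (1 / (m : ℝ)) with hq
  have hq1 : 1 ≤ q := Real.one_le_rpow hLR (by positivity)
  have hqm : q ^ m = L * R := by
    rw [hq, ← Real.rpow_natCast, ← Real.rpow_mul (by positivity), one_div_mul_cancel hm0.ne',
      Real.rpow_one]
  have hfi : ∀ i, IntegrableOn (f i) (U i) := fun i => by
    have : IsFiniteMeasure (volume.restrict (U i)) :=
      ⟨by
        rw [Measure.restrict_apply_univ]
        exact (measure_mono (hreg i).subset_ball).trans_lt measure_ball_lt_top⟩
    exact (hf i).integrable one_le_two
  have key := hmain V U S H μ hμ (fun i => (hreg i).mono (le_max_left _ _)) hcond q hq1 f hfi R (by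
    rw [hqm]
    gcongr
    exact le_max_right _ _)
  have hp0 : ENNReal.ofReal (2 / ((k : ℝ) - 1)) ≠ 0 := by
    rw [Ne, ENNReal.ofReal_eq_zero, not_le]
    positivity
  have htoReal : (ENNReal.ofReal (2 / ((k : ℝ) - 1))).toReal = 2 / ((k : ℝ) - 1) :=
    ENNReal.toReal_ofReal (by positivity)
  rw [eLpNorm_eq_lintegral_rpow_enorm_toReal hp0 ENNReal.ofReal_ne_top, htoReal]
  have h1r : 1 / (2 / ((k : ℝ) - 1)) = r := by rw [hr, one_div_div]
  have hint : ∀ x, ‖∏ i, extensionOp (U i) (S i) (f i) x‖ₑ ^ (2 / ((k : ℝ) - 1)) =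
      ∏ i, (‖extensionOp (U i) (S i) (f i) x‖ₑ ^ 2) ^ (1 / ((k : ℝ) - 1)) := by
    intro x
    have h2 : ‖∏ i, extensionOp (U i) (S i) (f i) x‖ₑ =
        ∏ i, ‖extensionOp (U i) (S i) (f i) x‖ₑ := by
      simp only [enorm, nnnorm_prod, ENNReal.ofNNReal_finsetProd]
    rw [h2, ← ENNReal.prod_rpow_of_nonneg (by positivity)]
    refine Finset.prod_congr rfl fun i _ => ?_
    rw [← ENNReal.rpow_natCast, ← ENNReal.rpow_mul]
    congr 1
    push_cast
    ring
  have hnorm : ∀ i, ((∫⁻ ξ in U i, ‖f i ξ‖ₑ ^ 2) ^ (1 / ((k : ℝ) - 1))) ^ r =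
      eLpNorm (f i) 2 (volume.restrict (U i)) := by
    intro i
    rw [eLpNorm_eq_lintegral_rpow_enorm_toReal two_ne_zero ENNReal.ofNat_ne_top, ← ENNReal.rpow_mul]
    have h3 : 1 / ((k : ℝ) - 1) * r = 1 / (2 : ℝ≥0∞).toReal := by
      rw [hr, ENNReal.toReal_ofNat]
      field_simp
    rw [h3]
    simp
  simp only [hint, h1r]
  refine (ENNReal.rpow_le_rpow key hr0.le).trans ?_
  rw [ENNReal.mul_rpow_of_nonneg _ _ hr0.le, ← ENNReal.prod_rpow_of_nonneg hr0.le]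
  simp only [hnorm]
  gcongr
  rw [ENNReal.ofReal_rpow_of_nonneg (by positivity) hr0.le]
  refine ENNReal.ofReal_le_ofReal ?_
  have hBq : 0 ≤ B * q := by positivity
  rw [Real.mul_rpow (by positivity) (by positivity), Real.mul_rpow hC (by positivity),
    ← Real.rpow_natCast (B * q), ← Real.rpow_mul hBq, ← Real.rpow_mul hBq, ← Real.rpow_mul hμ.le,
    hdcast]
  have hexp : (n : ℝ) * ((2 / ((k : ℝ) - 1) + 1) * k) * r = E := by rw [hE]; ring
  have hexp2 : (d : ℝ) / (k - 1) * r = d / 2 := by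
    rw [hr]
    field_simp
  rw [hexp, hexp2, Real.mul_rpow hB (by positivity)]
  have hqE : q ^ E ≤ L ^ ε * R ^ ε := by
    rw [hq, ← Real.rpow_mul (by positivity), ← Real.mul_rpow (by positivity) (by positivity)]
    refine Real.rpow_le_rpow_of_exponent_le hLR ?_
    calc 1 / (m : ℝ) * E = E / m := by ring
      _ ≤ ε := hEm
  calc B ^ E * q ^ E * (C ^ r * μ ^ ((d : ℝ) / 2))
      ≤ B ^ E * (L ^ ε * R ^ ε) * (C ^ r * μ ^ ((d : ℝ) / 2)) := by gcongr
    _ = B ^ E * C ^ r * L ^ ε * μ ^ ((d : ℝ) / 2) * R ^ ε := by ring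
    _ ≤ _ := by
        gcongr
        linarith
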